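/- There is an absolute constant $a>0$, and for every $\kappa>0$ there is a constant $K=K(\kappa)>0$, such that the following holds. Let $G$ be a graph on $V=\{1,\dots,n\}$ with maximum degree $d$, write $N(i)$ for the set of neighbors of $i$, let $s_1,\dots,s_n\ge 1$ be real speeds, and put $s_{\max}=\max_i s_i$. Let $\alpha_{i,j}=\alpha_{j,i}\ge 0$ (for $\{i,j\}\in E$) be edge parameters with $\sum_{j\in N(i)}\alpha_{i,j}\le 1$ for all $i$. Assume that either all speeds are equal, or $$\kappa\sum_{l\in N(k)}\alpha_{k,l}\le d\,\alpha_{i,j}\qquad\text{for every node }k\text{ and every edge }\{i,j\}$$ (for $\alpha_{i,j}=1/(\max(d_i,d_j)+1)$, $d_i$ the degree of $i$, this holds with $\kappa=\tfrac12$; for $\alpha_{i,j}=1/(\gamma d)$ it holds with $\kappa=1$). Let $M=I-LS^{-1}$, where $S=\mathrm{diag}(s_1,\dots,s_n)$ and $L$ is the Laplacian matrix of $G$ with edge weights $\alpha_{i,j}$; let $\lambda$ be the second-largest eigenvalue of $M$ in absolute value, counted with multiplicity ($\lambda=0$ if $n\le1$), and assume $\lambda<1$. The continuous first-order scheme $C$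 sends $\alpha_{i,j}(x_i/s_i-x_j/s_j)$ from $i$ to $j$ over each edge in each round, where $x$ is the current load vector, so that $x^C(t+1)=Mx^C(t)$. Let $Q_{k,i\to j}(t)$ be the difference of the loads of node $k$ after $t$ rounds of $C$ started from the $i$-th and from the $j$-th unit vector, and let $$\Upsilon^C(G)=\max_{k\in V}\Bigl(\sum_{t=0}^{\infty}\sum_{i=1}^n\max_{j\in N(i)}Q_{k,i\to j}(t)^2\Bigr)^{1/2}.$$ The discrete scheme $R$ works on integral load vectors $X$. In each round it computes $\hat Y_{i,j}=\alpha_{i,j}(X_i/s_i-X_j/s_j)$ for all edges. Node $i$ has $\lceil r_i\rceil$ excess tokens, where $r_i=\sum_{j\in N(i):\hat Y_{i,j}\ge0}\{\hat Y_{i,j}\}$ and $\{y\}=y-\lfloor y\rfloor$; independently of all other tokens, each of them leaves $i$ with probability $r_i/\lceil r_i\rceil$, and a leaving token goes to the neighbor $j$ (with $\hat Y_{i,j}\ge0$) with probability $\{\hat Y_{i,j}\}/r_i$. If $\hat Y_{i,j}\ge0$, the flow from $i$ to $j$ is $\lfloor\hat Y_{i,j}\rfloor$ plus the number of excess tokens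 that $i$ sends to $j$; otherwise it is minus the flow from $j$ to $i$. Then: (1) $\displaystyle \Upsilon^C(G)\le K\sqrt{\frac{d\,(1+\log s_{\max})}{1-\lambda}}$; in particular the series converge. (2) For every integral initial load vector, from which both $C$ and $R$ are started, and every round $t$, with probability at least $1-n^{-a}$, $$\bigl|x^R_k(t)-x^C_k(t)\bigr|\le K\,d\,\sqrt{\frac{\log n\,(1+\log s_{\max})}{1-\lambda}}\qquad\text{for all }k\in V.$$ -/

import Mathlib

/-! Discrete and continuous first-order diffusion load balancing on heterogeneous networks. -/

namespace Diffusion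

noncomputable section

/-! ### Continuous first-order diffusion -/

/-- The edge parameters `α` of a first-order scheme on `G`: symmetric, nonnegative on edges, with
`∑_{j ∈ N(i)} α i j ≤ 1` at every node. Values of `α` off the edges of `G` are never used. -/
structure IsParameter {V : Type*} [Fintype V] (G : SimpleGraph V) [DecidableRel G.Adj]
    (α : V → V → ℝ) : Prop where
  symm : ∀ i j, G.Adj i j → α i j = α j i
  nonneg : ∀ i j, G.Adj i j → 0 ≤ α i j
  sum_le_one : ∀ i, ∑ j ∈ G.neighborFinset i, α i j ≤ 1

/-- The Laplacian matrix of `G` with edge weights `α`. -/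
def laplacian {V : Type*} [Fintype V] [DecidableEq V] (G : SimpleGraph V) [DecidableRel G.Adj]
    (α : V → V → ℝ) : Matrix V V ℝ :=
  Matrix.of fun i j =>
    if i = j then ∑ l ∈ G.neighborFinset i, α i l else if G.Adj i j then -α i j else 0

/-- The diffusion matrix `M = I - L S⁻¹`, where `S` is the diagonal matrix of the speeds. -/
def diffusionMatrix {V : Type*} [Fintype V] [DecidableEq V] (G : SimpleGraph V)
    [DecidableRel G.Adj] (α : V → V → ℝ) (s : V → ℝ) : Matrix V V ℝ :=
  1 - laplacian G α * (Matrix.diagonal s)⁻¹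

/-- The second-largest eigenvalue in magnitude of a matrix all of whose eigenvalues are real:
list the absolute values of the eigenvalues, with multiplicity, in decreasing order, and take the
second entry (`0` for a matrix of size at most one). -/
def secondEigenvalue {V : Type*} [Fintype V] [DecidableEq V] (M : Matrix V V ℝ) : ℝ :=
  ((M.charpoly.roots.map fun μ => |μ|).sort (· ≥ ·)).getD 1 0

/-- The continuous first-order scheme as a map from loads to flows: with loads `x`, the amount
sent from `i` to `j` over an edge is `α i j * (x i / s i - x j / s j)`. -/
def flow {V : Type*} (G : SimpleGraph V) [DecidableRel G.Adj] (α : V → V → ℝ) (s : V → ℝ)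
    (x : V → ℝ) (i j : V) : ℝ :=
  if G.Adj i j then α i j * (x i / s i - x j / s j) else 0

/-- The loads of the continuous first-order scheme at the beginning of round `t`, started from the
load vector `x₀`. -/
def contLoad {V : Type*} [Fintype V] (G : SimpleGraph V) [DecidableRel G.Adj]
    (α : V → V → ℝ) (s : V → ℝ) (x₀ : V → ℝ) : ℕ → V → ℝ
  | 0 => x₀
  | t + 1 => fun i => contLoad G α s x₀ t i -
      ∑ j ∈ G.neighborFinset i, flow G α s (contLoad G α s x₀ t) i j

/-- One round of the continuous scheme is multiplication by the diffusion matrix. -/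
theorem contLoad_succ {V : Type*} [Fintype V] [DecidableEq V] (G : SimpleGraph V)
    [DecidableRel G.Adj] (α : V → V → ℝ) (s : V → ℝ) (hs : ∀ i, s i ≠ 0) (x₀ : V → ℝ) (t : ℕ) :
    contLoad G α s x₀ (t + 1) = (diffusionMatrix G α s).mulVec (contLoad G α s x₀ t) := by
  have hmul : ∀ j, ((Matrix.diagonal s)⁻¹.mulVec (contLoad G α s x₀ t)) j =
      contLoad G α s x₀ t j / s j := by
    have hinv : (Matrix.diagonal s)⁻¹ = Matrix.diagonal fun i => (s i)⁻¹ := by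
      refine Matrix.inv_eq_left_inv ?_
      rw [Matrix.diagonal_mul_diagonal, ← Matrix.diagonal_one]
      congr 1
      funext i
      exact inv_mul_cancel₀ (hs i)
    intro j
    rw [hinv, Matrix.mulVec_diagonal, div_eq_inv_mul]
  funext i
  rw [diffusionMatrix, Matrix.sub_mulVec, Matrix.one_mulVec, ← Matrix.mulVec_mulVec]
  simp only [contLoad, Pi.sub_apply]
  congr 1
  rw [Matrix.mulVec, dotProduct]
  simp only [hmul, laplacian, Matrix.of_apply]
  rw [← Finset.add_sum_erase _ _ (Finset.mem_univ i), if_pos rfl]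
  have h : ∑ j ∈ Finset.univ.erase i, (if i = j then ∑ l ∈ G.neighborFinset i, α i l
        else if G.Adj i j then -α i j else 0) * (contLoad G α s x₀ t j / s j) =
      ∑ j ∈ G.neighborFinset i, -α i j * (contLoad G α s x₀ t j / s j) := by
    symm
    refine Finset.sum_subset_zero_on_sdiff ?_ ?_ ?_
    · intro j hj
      rw [SimpleGraph.mem_neighborFinset] at hj
      exact Finset.mem_erase.2 ⟨hj.ne', Finset.mem_univ _⟩
    · intro j hj
      rw [Finset.mem_sdiff, Finset.mem_erase, SimpleGraph.mem_neighborFinset] at hj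
      rw [if_neg (Ne.symm hj.1.1), if_neg hj.2, zero_mul]
    · intro j hj
      rw [SimpleGraph.mem_neighborFinset] at hj
      rw [if_neg hj.ne, if_pos hj]
  rw [h, Finset.sum_mul, ← Finset.sum_add_distrib]
  refine Finset.sum_congr rfl fun j hj => ?_
  rw [SimpleGraph.mem_neighborFinset] at hj
  rw [flow, if_pos hj]
  ring

/-- The contribution of the edge `(i, j)` on the node `k` after `t` rounds: the difference of the
loads of `k` after `t` rounds of the continuous scheme started from the unit vectors of `i`
and of `j`. -/
def contribution {V : Type*} [Fintype V] [DecidableEq V] (G : SimpleGraph V)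
    [DecidableRel G.Adj] (α : V → V → ℝ) (s : V → ℝ) (k i j : V) (t : ℕ) : ℝ :=
  contLoad G α s (Pi.single i 1) t k - contLoad G α s (Pi.single j 1) t k

/-- The refined local divergence
`max_k (∑_{t ≥ 0} ∑_i max_{j ∈ N(i)} (contribution of (i, j) on k after t rounds)²)^(1/2)`,
as an extended nonnegative real: it is `∞` if a series diverges. -/
def refinedLocalDivergence {V : Type*} [Fintype V] [DecidableEq V] (G : SimpleGraph V)
    [DecidableRel G.Adj] (α : V → V → ℝ) (s : V → ℝ) : ENNReal :=
  ⨆ k : V, (∑' t : ℕ, ∑ i : V, ⨆ j : V, ⨆ _ : G.Adj i j,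
    ENNReal.ofReal (contribution G α s k i j t ^ 2)) ^ (1 / 2 : ℝ)

/-! ### Randomized rounding -/

/-- The product distribution of finitely many distributions on finite types: independent
choices. -/
def independent {ι : Type*} [Fintype ι] [DecidableEq ι] {β : ι → Type*} [∀ i, Fintype (β i)]
    (p : ∀ i, PMF (β i)) : PMF (∀ i, β i) :=
  PMF.ofFintype (fun ω => ∏ i, p i (ω i)) (by
    have h := Finset.prod_univ_sum (fun i => (Finset.univ : Finset (β i))) (fun i b => p i b)
    rw [Fintype.piFinset_univ] at h
    rw [← h]
    refine Finset.prod_eq_one fun i _ => ?_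
    rw [← tsum_fintype (L := .unconditional _)]
    exact (p i).tsum_coe)

/-- The excess load `r` left on node `i` when the scheduled flows `Y` are rounded down. -/
def excess {V : Type*} [Fintype V] (G : SimpleGraph V) [DecidableRel G.Adj] (Y : V → V → ℝ)
    (i : V) : ℝ :=
  ∑ j ∈ G.neighborFinset i, if 0 ≤ Y i j then Int.fract (Y i j) else 0

/-- The probability that a given excess token of node `i` ends up at `j`: each of the `⌈r⌉` tokens
leaves `i` with probability `r / ⌈r⌉`, and a leaving token goes to a neighbor `j` with `0 ≤ Y i j`
with probability `{Y i j} / r`. -/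
def tokenProb {V : Type*} [Fintype V] [DecidableEq V] (G : SimpleGraph V) [DecidableRel G.Adj]
    (Y : V → V → ℝ) (i j : V) : ℝ :=
  if j = i then 1 - excess G Y i / ⌈excess G Y i⌉₊
  else if G.Adj i j ∧ 0 ≤ Y i j then
    (excess G Y i / ⌈excess G Y i⌉₊) * (Int.fract (Y i j) / excess G Y i)
  else 0

theorem excess_nonneg {V : Type*} [Fintype V] (G : SimpleGraph V) [DecidableRel G.Adj]
    (Y : V → V → ℝ) (i : V) : 0 ≤ excess G Y i :=
  Finset.sum_nonneg fun j _ => by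
    split_ifs
    · exact Int.fract_nonneg _
    · exact le_rfl

theorem tokenProb_nonneg {V : Type*} [Fintype V] [DecidableEq V] (G : SimpleGraph V)
    [DecidableRel G.Adj] (Y : V → V → ℝ) (i j : V) : 0 ≤ tokenProb G Y i j := by
  have h := excess_nonneg G Y i
  unfold tokenProb
  split_ifs
  · exact sub_nonneg.2 (div_le_one_of_le₀ (Nat.le_ceil _) (Nat.cast_nonneg _))
  · have := Int.fract_nonneg (Y i j)
    positivity
  · exact le_rfl

theorem sum_tokenProb {V : Type*} [Fintype V] [DecidableEq V] (G : SimpleGraph V)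
    [DecidableRel G.Adj] (Y : V → V → ℝ) (i : V) : ∑ j, tokenProb G Y i j = 1 := by
  rw [← Finset.add_sum_erase _ _ (Finset.mem_univ i)]
  have h : ∑ j ∈ Finset.univ.erase i, tokenProb G Y i j = ∑ j ∈ G.neighborFinset i,
      (excess G Y i / ⌈excess G Y i⌉₊) *
        ((if 0 ≤ Y i j then Int.fract (Y i j) else 0) / excess G Y i) := by
    symm
    refine Finset.sum_subset_zero_on_sdiff ?_ ?_ ?_
    · intro j hj
      rw [SimpleGraph.mem_neighborFinset] at hj
      exact Finset.mem_erase.2 ⟨hj.ne', Finset.mem_univ _⟩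
    · intro j hj
      rw [Finset.mem_sdiff, Finset.mem_erase, SimpleGraph.mem_neighborFinset] at hj
      rw [tokenProb, if_neg hj.1.1, if_neg fun h => hj.2 h.1]
    · intro j hj
      rw [SimpleGraph.mem_neighborFinset] at hj
      rw [tokenProb, if_neg hj.ne']
      by_cases hY : 0 ≤ Y i j
      · simp only [hj, hY, and_self, if_true]
      · simp only [hY, and_false, if_false, zero_div, mul_zero]
  rw [h, ← Finset.mul_sum, ← Finset.sum_div, tokenProb, if_pos rfl]
  change _ + _ * (excess G Y i / excess G Y i) = 1
  by_cases hr : excess G Y i = 0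
  · simp [hr]
  · rw [div_self hr]
    ring

/-- The distribution of the final position of one excess token of node `i`. -/
def tokenPMF {V : Type*} [Fintype V] [DecidableEq V] (G : SimpleGraph V) [DecidableRel G.Adj]
    (Y : V → V → ℝ) (i : V) : PMF V :=
  PMF.ofFintype (fun j => ENNReal.ofReal (tokenProb G Y i j)) (by
    rw [← ENNReal.ofReal_sum_of_nonneg fun j _ => tokenProb_nonneg G Y i j, sum_tokenProb,
      ENNReal.ofReal_one])

/-- The final positions of all excess tokens in one round: node `i` has `⌈r⌉` of them. -/
abbrev Destinations {V : Type*} [Fintype V] (G : SimpleGraph V) [DecidableRel G.Adj]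
    (Y : V → V → ℝ) : Type _ :=
  ∀ i : V, Fin ⌈excess G Y i⌉₊ → V

/-- All excess tokens of all nodes choose their positions independently. -/
def destinationsPMF {V : Type*} [Fintype V] [DecidableEq V] (G : SimpleGraph V)
    [DecidableRel G.Adj] (Y : V → V → ℝ) : PMF (Destinations G Y) :=
  independent fun i => independent fun _ => tokenPMF G Y i

/-- The integral flow: `⌊Y i j⌋` plus the number of excess tokens that `i` sends to `j` if
`0 ≤ Y i j`, and minus the flow from `j` to `i` otherwise. -/
def roundedFlow {V : Type*} [Fintype V] [DecidableEq V] (G : SimpleGraph V) [DecidableRel G.Adj]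
    (Y : V → V → ℝ) (ω : Destinations G Y) (i j : V) : ℤ :=
  if 0 ≤ Y i j then ⌊Y i j⌋ + (Finset.univ.filter fun b => ω i b = j).card
  else -(⌊Y j i⌋ + (Finset.univ.filter fun b => ω j b = i).card)

/-- One round of the discrete scheme: the flow that the continuous scheme would use on the
current (integral) loads is rounded randomly and then sent. -/
def discreteStep {V : Type*} [Fintype V] [DecidableEq V] (G : SimpleGraph V) [DecidableRel G.Adj]
    (α : V → V → ℝ) (s : V → ℝ) (X : V → ℤ) : PMF (V → ℤ) :=
  (destinationsPMF G (flow G α s fun i => (X i : ℝ))).map fun ω i =>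
    X i - ∑ j ∈ G.neighborFinset i, roundedFlow G (flow G α s fun i => (X i : ℝ)) ω i j

/-- The distribution of the load vector of the randomized-rounding discrete scheme at the
beginning of round `t`, started from the integral load vector `x₀`. -/
def discreteLoad {V : Type*} [Fintype V] [DecidableEq V] (G : SimpleGraph V) [DecidableRel G.Adj]
    (α : V → V → ℝ) (s : V → ℝ) (x₀ : V → ℤ) : ℕ → PMF (V → ℤ)
  | 0 => PMF.pure x₀
  | t + 1 => (discreteLoad G α s x₀ t).bind (discreteStep G α s)

end

end Diffusion

/-! Both bounds rest on one estimate: along the rows of `M ^ t`, the sum of squared differences over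
edges (`gradientSq`) is at most a constant times `d * λ ^ (2 * t)`. Its sum over time is of order `d
/ (1 - λ)`; no logarithm of the speeds arises, so the factor `1 + log s_max ≥ 1` is only slack.

For this estimate, conjugate `M` by `S ^ (1/2)` to a symmetric matrix with the same spectrum that
fixes the vector of the `√(s i)`. Since `λ < 1`, the eigenvalue `1` is simple and all other
eigenvalues have modulus at most `λ`. If all speeds are equal, contraction orthogonally to the fixed
vector bounds the variance of a row, and the gradient is at most `4 * d` times the variance.
Otherwise the Dirichlet form decays like `λ ^ (2 * t)`; it starts from the weighted degree of `k`,
and the hypothesis with `κ` compares that weighted degree with each single edge weight, so that it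
cancels (`gradientSq_row_le`).

For the random scheme, the error of one round tested against `g` is a sum of independent centred
contributions of the excess tokens. A token of `i` moves to a neighbor or stays, and `i` has at most
`d` tokens, so Hoeffding's lemma bounds the exponential moment by `exp (d / 2 * gradientSq g)`
(`sum_destinationsPMF_mul_exp_le`). Errors then evolve linearly under `M`: going back one round
replaces `g` by `g ᵥ* M`. Starting from `θ` times a unit vector, the accumulated exponent is `θ ^ 2
* d / 2` times the sum of gradients of the rows. A Chernoff bound and a union bound over the nodes
finish the proof. -/

namespace Diffusion

open Matrix

/-! ### The second eigenvalue of a symmetric matrix -/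

/-- In a multiset of reals, at most one element exceeds the second entry of the decreasing
rearrangement. -/
theorem le_getD_one_sort_of_pair_le {R : Multiset ℝ} {x y : ℝ} (h : {x, y} ≤ R)
    (hx : (R.sort (· ≥ ·)).getD 1 0 < x) : y ≤ (R.sort (· ≥ ·)).getD 1 0 := by
  have hR : ((R.sort (· ≥ ·) : List ℝ) : Multiset ℝ) = R := R.sort_eq _
  have hs := R.pairwise_sort (· ≥ ·)
  rw [← hR] at h
  revert hx h hs
  generalize R.sort (· ≥ ·) = l
  intro h hx hs
  have hcard := Multiset.card_le_card h
  rcases l with _ | ⟨a, _ | ⟨b, l⟩⟩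
  · simp at hcard
  · simp at hcard
  · by_contra! hy
    simp only [List.getD_cons_succ, List.getD_cons_zero] at hx hy
    -- Count the elements above the second entry `b`: the pair would supply two, but in a decreasing
    -- list only the head can exceed `b`.
    have hf := Multiset.card_le_card (Multiset.filter_le_filter (fun z => b < z) h)
    have hnil : l.filter (fun z => b < z) = [] := by
      rw [List.filter_eq_nil_iff]
      intro z hz
      simpa using (List.pairwise_cons.1 (List.pairwise_cons.1 hs).2).1 z hz
    have h2 : Multiset.card (Multiset.filter (fun z => b < z) ({x, y} : Multiset ℝ)) = 2 := by
      rw [Multiset.filter_eq_self.2]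
      · rfl
      · intro z hz
        rcases Multiset.mem_cons.1 hz with rfl | hz
        · exact hx
        · rwa [Multiset.mem_singleton.1 hz]
    rw [h2, Multiset.filter_coe, Multiset.coe_card, List.filter_cons, List.filter_cons, hnil] at hf
    simp only [lt_self_iff_false, decide_false, Bool.false_eq_true, if_false] at hf
    split_ifs at hf <;> simp at hf

variable {V : Type*} [Fintype V] [DecidableEq V]

theorem secondEigenvalue_nonneg (A : Matrix V V ℝ) : 0 ≤ secondEigenvalue A := by
  unfold secondEigenvalue
  rw [List.getD_eq_getElem?_getD]
  rcases h : ((A.charpoly.roots.map fun μ => |μ|).sort (· ≥ ·))[1]? with _ | x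
  · exact le_rfl
  · have hx := List.mem_of_getElem? h
    rw [Multiset.mem_sort, Multiset.mem_map] at hx
    obtain ⟨μ, -, rfl⟩ := hx
    exact abs_nonneg μ

/-- Orthonormal coordinates that diagonalize a real symmetric matrix. -/
theorem exists_diagonalizing_coordinates {A : Matrix V V ℝ} (hA : A.IsHermitian) :
    ∃ (c : (V → ℝ) →ₗ[ℝ] (V → ℝ)) (μ : V → ℝ),
      (∀ v m, c (A *ᵥ v) m = μ m * c v m) ∧ (∀ v w, v ⬝ᵥ w = c v ⬝ᵥ c w) ∧
      A.charpoly.roots = Finset.univ.val.map μ := by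
  refine ⟨(Matrix.of fun m i => hA.eigenvectorBasis m i).mulVecLin, hA.eigenvalues, ?_, ?_, ?_⟩
  · intro v m
    simp only [mulVecLin_apply]
    change (hA.eigenvectorBasis m).ofLp ⬝ᵥ (A *ᵥ v) =
      hA.eigenvalues m * ((hA.eigenvectorBasis m).ofLp ⬝ᵥ v)
    have hT : Aᵀ = A := by simpa [Matrix.IsHermitian] using hA
    rw [dotProduct_mulVec, ← mulVec_transpose, hT, hA.mulVec_eigenvectorBasis, smul_dotProduct,
      smul_eq_mul]
  · intro v w
    have h := hA.eigenvectorBasis.sum_inner_mul_inner (WithLp.toLp 2 v) (WithLp.toLp 2 w)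
    simp only [PiLp.inner_apply, RCLike.inner_apply, conj_trivial] at h
    simp only [mulVecLin_apply, dotProduct, mulVec, of_apply]
    rw [Finset.sum_congr rfl fun i _ => mul_comm (v i) (w i), ← h]
    refine Finset.sum_congr rfl fun m _ => ?_
    congr 1
    exact Finset.sum_congr rfl fun i _ => mul_comm _ _
  · simpa [Function.comp_def] using! hA.roots_charpoly_eq_eigenvalues

/-- If `u` is a fixed vector of a symmetric matrix with second eigenvalue less than `1`, then in
suitable orthonormal coordinates `u` spans one axis and the matrix contracts all others. -/
theorem exists_coordinates_of_fixed {A : Matrix V V ℝ} (hA : A.IsHermitian) {u : V → ℝ}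
    (hu : u ≠ 0) (hAu : A *ᵥ u = u) (hl : secondEigenvalue A < 1) :
    ∃ (c : (V → ℝ) →ₗ[ℝ] (V → ℝ)) (μ : V → ℝ) (m₀ : V),
      (∀ v m, c (A *ᵥ v) m = μ m * c v m) ∧ (∀ v w, v ⬝ᵥ w = c v ⬝ᵥ c w) ∧ μ m₀ = 1 ∧
      (∀ m, m ≠ m₀ → |μ m| ≤ secondEigenvalue A) ∧ (∀ m, m ≠ m₀ → c u m = 0) ∧ c u m₀ ≠ 0 := by
  obtain ⟨c, μ, hc, hdot, hroots⟩ := exists_diagonalizing_coordinates hA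
  have hcu : ∃ m, c u m ≠ 0 := by
    by_contra! h
    refine hu (dotProduct_self_eq_zero.1 ?_)
    rw [hdot, show c u = 0 from funext h, dotProduct_zero]
  obtain ⟨m₀, hm₀⟩ := hcu
  have hfix : ∀ m, c u m ≠ 0 → μ m = 1 := fun m hm => by
    have h := hc u m
    rw [hAu] at h
    exact mul_right_cancel₀ hm (by linarith)
  have hgap : ∀ m, m ≠ m₀ → |μ m| ≤ secondEigenvalue A := fun m hm => by
    -- The eigenvalue at `m₀` is `1`, which exceeds the second entry, so any other index must lie at
    -- or below that entry.
    refine le_getD_one_sort_of_pair_le (x := |μ m₀|) ?_ ?_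
    · rw [hroots, Multiset.map_map]
      have h : ({m₀, m} : Finset V).val ≤ Finset.univ.val :=
        Finset.val_le_iff.2 (Finset.subset_univ _)
      have h' := Multiset.map_le_map (f := (fun ν => |ν|) ∘ μ) h
      rwa [Finset.insert_val_of_notMem (by simpa using hm.symm)] at h'
    · rw [hfix m₀ hm₀, abs_one]
      exact hl
  refine ⟨c, μ, m₀, hc, hdot, hfix m₀ hm₀, hgap, fun m hm => ?_, hm₀⟩
  by_contra h
  have := hgap m hm
  rw [hfix m h, abs_one] at this
  linarith

theorem coordinates_pow_mulVec {A : Matrix V V ℝ} {c : (V → ℝ) →ₗ[ℝ] (V → ℝ)} {μ : V → ℝ}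
    (hc : ∀ v m, c (A *ᵥ v) m = μ m * c v m) (v : V → ℝ) (m : V) (t : ℕ) :
    c ((A ^ t) *ᵥ v) m = μ m ^ t * c v m := by
  induction t with
  | zero => simp
  | succ t ih => rw [pow_succ', ← mulVec_mulVec, hc, ih]; ring

theorem pow_sq_le_of_abs_le {x l : ℝ} (h : |x| ≤ l) (t : ℕ) : (x ^ t) ^ 2 ≤ (l ^ t) ^ 2 := by
  rw [← sq_abs, abs_pow]
  gcongr

/-- On the orthogonal complement of the fixed vector the powers of a symmetric matrix contract at
the rate given by the second eigenvalue. -/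
theorem dotProduct_pow_mulVec_le {A : Matrix V V ℝ} (hA : A.IsHermitian) {u : V → ℝ}
    (hu : u ≠ 0) (hAu : A *ᵥ u = u) (hl : secondEigenvalue A < 1) {v : V → ℝ} (hv : v ⬝ᵥ u = 0)
    (t : ℕ) :
    ((A ^ t) *ᵥ v) ⬝ᵥ ((A ^ t) *ᵥ v) ≤ (secondEigenvalue A ^ t) ^ 2 * (v ⬝ᵥ v) := by
  obtain ⟨c, μ, m₀, hc, hdot, -, hgap, hcu, hm₀⟩ := exists_coordinates_of_fixed hA hu hAu hl
  have hv₀ : c v m₀ = 0 := by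
    rw [hdot, dotProduct, Finset.sum_eq_single m₀ (fun m _ hm => by rw [hcu m hm, mul_zero])
      (fun h => absurd (Finset.mem_univ _) h)] at hv
    exact (mul_eq_zero.1 hv).resolve_right hm₀
  rw [hdot, hdot v v, dotProduct, dotProduct, Finset.mul_sum]
  refine Finset.sum_le_sum fun m _ => ?_
  rw [coordinates_pow_mulVec hc]
  by_cases hm : m = m₀
  · simp [hm, hv₀]
  · have := mul_le_mul_of_nonneg_right (pow_sq_le_of_abs_le (hgap m hm) t) (mul_self_nonneg (c v m))
    linarith

/-- The Dirichlet form of a symmetric matrix decays along its powers at the rate given by the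
second eigenvalue. -/
theorem dirichlet_pow_mulVec_le {A : Matrix V V ℝ} (hA : A.IsHermitian) {u : V → ℝ}
    (hu : u ≠ 0) (hAu : A *ᵥ u = u) (hl : secondEigenvalue A < 1) (v : V → ℝ) (t : ℕ) :
    ((A ^ t) *ᵥ v) ⬝ᵥ ((1 - A) *ᵥ ((A ^ t) *ᵥ v)) ≤
      (secondEigenvalue A ^ t) ^ 2 * (v ⬝ᵥ ((1 - A) *ᵥ v)) := by
  obtain ⟨c, μ, m₀, hc, hdot, h1, hgap, -, -⟩ := exists_coordinates_of_fixed hA hu hAu hl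
  rw [hdot, hdot v, dotProduct, dotProduct, Finset.mul_sum]
  refine Finset.sum_le_sum fun m _ => ?_
  rw [sub_mulVec, sub_mulVec, one_mulVec, one_mulVec, map_sub, map_sub, Pi.sub_apply, Pi.sub_apply,
    hc, hc, coordinates_pow_mulVec hc]
  -- The coordinate along the fixed vector does not decay, but the factor `1 - μ m₀ = 0` removes it
  -- from the form.
  by_cases hm : m = m₀
  · simp [hm, h1]
  · have h : 0 ≤ (1 - μ m) * (c v m * c v m) :=
      mul_nonneg (by linarith [le_abs_self (μ m), hgap m hm]) (mul_self_nonneg _)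
    have := mul_le_mul_of_nonneg_right (pow_sq_le_of_abs_le (hgap m hm) t) h
    linarith

/-- The Dirichlet form vanishes only on multiples of the fixed vector. -/
theorem exists_eq_smul_of_dirichlet_nonpos {A : Matrix V V ℝ} (hA : A.IsHermitian) {u : V → ℝ}
    (hu : u ≠ 0) (hAu : A *ᵥ u = u) (hl : secondEigenvalue A < 1) {v : V → ℝ}
    (hv : v ⬝ᵥ ((1 - A) *ᵥ v) ≤ 0) : ∃ r : ℝ, v = r • u := by
  obtain ⟨c, μ, m₀, hc, hdot, h1, hgap, hcu, hm₀⟩ := exists_coordinates_of_fixed hA hu hAu hl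
  have hterm : ∀ m, c v m * c ((1 - A) *ᵥ v) m = (1 - μ m) * (c v m * c v m) := fun m => by
    rw [sub_mulVec, one_mulVec, map_sub, Pi.sub_apply, hc]
    ring
  have hpos : ∀ m, m ≠ m₀ → 0 < 1 - μ m := fun m hm => by
    linarith [le_abs_self (μ m), hgap m hm]
  have hnn : ∀ m ∈ Finset.univ, 0 ≤ c v m * c ((1 - A) *ᵥ v) m := fun m _ => by
    rw [hterm]
    by_cases hm : m = m₀
    · simp [hm, h1]
    · exact mul_nonneg (hpos m hm).le (mul_self_nonneg _)
  rw [hdot] at hv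
  have hzero := (Finset.sum_eq_zero_iff_of_nonneg hnn).1 (le_antisymm hv (Finset.sum_nonneg hnn))
  refine ⟨c v m₀ / c u m₀, sub_eq_zero.1 (dotProduct_self_eq_zero.1 ?_)⟩
  rw [hdot, map_sub, map_smul]
  refine Finset.sum_eq_zero fun m _ => mul_self_eq_zero.2 ?_
  simp only [Pi.sub_apply, Pi.smul_apply, smul_eq_mul]
  by_cases hm : m = m₀
  · rw [hm, div_mul_cancel₀ _ hm₀, sub_self]
  · have h := hzero m (Finset.mem_univ m)
    rw [hterm] at h
    rw [hcu m hm, mul_self_eq_zero.1 ((mul_eq_zero.1 h).resolve_left (hpos m hm).ne')]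
    ring

end Diffusion

namespace Diffusion

open Matrix

variable {V : Type*} [Fintype V]

/-! ### Sums over the edges of a graph -/

theorem sum_neighborFinset_comm (G : SimpleGraph V) [DecidableRel G.Adj] (F : V → V → ℝ) :
    ∑ i, ∑ j ∈ G.neighborFinset i, F i j = ∑ i, ∑ j ∈ G.neighborFinset i, F j i :=
  Finset.sum_comm' fun i j => by simp [SimpleGraph.adj_comm]

/-- The sum of the squared differences of `f` over all directed edges. -/
noncomputable def gradientSq (G : SimpleGraph V) [DecidableRel G.Adj] (f : V → ℝ) : ℝ :=
  ∑ i, ∑ j ∈ G.neighborFinset i, (f i - f j) ^ 2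

/-- The sum of the squared differences of `f` over all directed edges, weighted by `α`. -/
noncomputable def energy (G : SimpleGraph V) [DecidableRel G.Adj] (α : V → V → ℝ) (f : V → ℝ) :
    ℝ :=
  ∑ i, ∑ j ∈ G.neighborFinset i, α i j * (f i - f j) ^ 2

theorem gradientSq_smul (G : SimpleGraph V) [DecidableRel G.Adj] (θ : ℝ) (f : V → ℝ) :
    gradientSq G (θ • f) = θ ^ 2 * gradientSq G f := by
  simp only [gradientSq, Finset.mul_sum, Pi.smul_apply, smul_eq_mul]
  refine Finset.sum_congr rfl fun i _ => Finset.sum_congr rfl fun j _ => ?_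
  ring

theorem gradientSq_const (G : SimpleGraph V) [DecidableRel G.Adj] {f : V → ℝ}
    (h : ∀ i j, f i = f j) : gradientSq G f = 0 :=
  Finset.sum_eq_zero fun i _ => Finset.sum_eq_zero fun j _ => by rw [h i j]; ring

/-- This is `(a - b) ^ 2 ≤ 2 * a ^ 2 + 2 * b ^ 2` for the deviations from `r`; each node then occurs
in at most `d` edges in each direction. -/
theorem gradientSq_le (G : SimpleGraph V) [DecidableRel G.Adj] (f : V → ℝ) (r : ℝ) :
    gradientSq G f ≤ 4 * G.maxDegree * ∑ i, (f i - r) ^ 2 := by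
  have h : gradientSq G f ≤ ∑ i, ∑ j ∈ G.neighborFinset i, (2 * (f i - r) ^ 2 + 2 * (f j - r) ^ 2) :=
    Finset.sum_le_sum fun i _ => Finset.sum_le_sum fun j _ => by
      nlinarith [sq_nonneg ((f i - r) + (f j - r))]
  refine h.trans ?_
  simp only [Finset.sum_add_distrib]
  rw [sum_neighborFinset_comm G fun _ j => 2 * (f j - r) ^ 2, ← two_mul]
  simp only [Finset.sum_const, SimpleGraph.card_neighborFinset_eq_degree, nsmul_eq_mul]
  rw [Finset.mul_sum, Finset.mul_sum]
  refine Finset.sum_le_sum fun i _ => ?_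
  have hd : (G.degree i : ℝ) ≤ G.maxDegree := by exact_mod_cast G.degree_le_maxDegree i
  nlinarith [mul_le_mul_of_nonneg_right hd (sq_nonneg (f i - r))]

/-- Applied with `b` equal to `κ` times the weighted degree of a node and `c` the maximum degree, as
the second speed hypothesis allows. -/
theorem gradientSq_le_energy (G : SimpleGraph V) [DecidableRel G.Adj] (α : V → V → ℝ) {b : ℝ}
    {c : ℝ} (h : ∀ i j, G.Adj i j → b ≤ c * α i j) (f : V → ℝ) :
    b * gradientSq G f ≤ c * energy G α f := by
  rw [gradientSq, energy, Finset.mul_sum, Finset.mul_sum]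
  refine Finset.sum_le_sum fun i _ => ?_
  rw [Finset.mul_sum, Finset.mul_sum]
  refine Finset.sum_le_sum fun j hj => ?_
  rw [← mul_assoc]
  exact mul_le_mul_of_nonneg_right (h i j ((G.mem_neighborFinset i j).1 hj)) (sq_nonneg _)

variable [DecidableEq V]

theorem energy_single (G : SimpleGraph V) [DecidableRel G.Adj] {α : V → V → ℝ}
    (hα : IsParameter G α) (k : V) :
    energy G α (Pi.single k 1) = 2 * ∑ l ∈ G.neighborFinset k, α k l := by
  have hk : ∀ i, ∑ j ∈ G.neighborFinset i, α i j * ((Pi.single k 1 : V → ℝ) i -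
      (Pi.single k 1 : V → ℝ) j) ^ 2 =
      ∑ j ∈ G.neighborFinset i, α i j * (Pi.single k 1 : V → ℝ) i +
      ∑ j ∈ G.neighborFinset i, α i j * (Pi.single k 1 : V → ℝ) j := fun i => by
    rw [← Finset.sum_add_distrib]
    refine Finset.sum_congr rfl fun j hj => ?_
    have hij := ((G.mem_neighborFinset i j).1 hj).ne
    rw [← mul_add]
    congr 1
    simp only [Pi.single_apply]
    split_ifs with h1 h2 h2
    · exact absurd (h1.trans h2.symm) hij
    all_goals norm_num
  rw [energy, Finset.sum_congr rfl fun i _ => hk i, Finset.sum_add_distrib,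
    sum_neighborFinset_comm G fun i j => α i j * (Pi.single k 1 : V → ℝ) j]
  have hs : ∑ i, ∑ j ∈ G.neighborFinset i, α j i * (Pi.single k 1 : V → ℝ) i =
      ∑ i, ∑ j ∈ G.neighborFinset i, α i j * (Pi.single k 1 : V → ℝ) i :=
    Finset.sum_congr rfl fun i _ => Finset.sum_congr rfl fun j hj => by
      rw [hα.symm i j ((G.mem_neighborFinset i j).1 hj)]
  rw [hs, ← two_mul, Finset.sum_eq_single k]
  · simp
  · intro i _ hi
    simp [hi]
  · simp

/-! ### The Laplacian and the symmetrized diffusion matrix -/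

theorem laplacian_mulVec (G : SimpleGraph V) [DecidableRel G.Adj] (α : V → V → ℝ) (x : V → ℝ)
    (i : V) :
    (laplacian G α *ᵥ x) i = ∑ j ∈ G.neighborFinset i, α i j * (x i - x j) := by
  rw [mulVec, dotProduct]
  simp only [laplacian, of_apply]
  rw [← Finset.add_sum_erase _ _ (Finset.mem_univ i), if_pos rfl]
  have h : ∑ j ∈ Finset.univ.erase i, (if i = j then ∑ l ∈ G.neighborFinset i, α i l
        else if G.Adj i j then -α i j else 0) * x j =
      ∑ j ∈ G.neighborFinset i, -α i j * x j := by
    symm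
    refine Finset.sum_subset_zero_on_sdiff ?_ ?_ ?_
    · intro j hj
      rw [SimpleGraph.mem_neighborFinset] at hj
      exact Finset.mem_erase.2 ⟨hj.ne', Finset.mem_univ _⟩
    · intro j hj
      rw [Finset.mem_sdiff, Finset.mem_erase, SimpleGraph.mem_neighborFinset] at hj
      rw [if_neg (Ne.symm hj.1.1), if_neg hj.2, zero_mul]
    · intro j hj
      rw [SimpleGraph.mem_neighborFinset] at hj
      rw [if_neg hj.ne, if_pos hj]
  rw [h, Finset.sum_mul, ← Finset.sum_add_distrib]
  exact Finset.sum_congr rfl fun j _ => by ring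

theorem dotProduct_laplacian_mulVec (G : SimpleGraph V) [DecidableRel G.Adj] {α : V → V → ℝ}
    (hα : IsParameter G α) (f : V → ℝ) :
    2 * (f ⬝ᵥ (laplacian G α *ᵥ f)) = energy G α f := by
  simp only [dotProduct, laplacian_mulVec, Finset.mul_sum]
  have h := sum_neighborFinset_comm G fun i j => f i * (α i j * (f i - f j))
  have h2 : ∑ i, ∑ j ∈ G.neighborFinset i, 2 * (f i * (α i j * (f i - f j))) =
      ∑ i, ∑ j ∈ G.neighborFinset i, f i * (α i j * (f i - f j)) +
        ∑ i, ∑ j ∈ G.neighborFinset i, f i * (α i j * (f i - f j)) := by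
    simp only [← Finset.sum_add_distrib, two_mul]
  rw [h2]
  nth_rw 2 [h]
  rw [← Finset.sum_add_distrib]
  refine Finset.sum_congr rfl fun i _ => ?_
  rw [← Finset.sum_add_distrib]
  refine Finset.sum_congr rfl fun j hj => ?_
  rw [← hα.symm i j ((G.mem_neighborFinset i j).1 hj)]
  ring

theorem laplacian_isSymm (G : SimpleGraph V) [DecidableRel G.Adj] {α : V → V → ℝ}
    (hα : IsParameter G α) (i j : V) : laplacian G α i j = laplacian G α j i := by
  simp only [laplacian, of_apply]
  by_cases h : i = j
  · rw [h]
  · rw [if_neg h, if_neg (Ne.symm h)]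
    by_cases hij : G.Adj i j
    · rw [if_pos hij, if_pos hij.symm, hα.symm i j hij]
    · rw [if_neg hij, if_neg fun h' => hij h'.symm]

theorem diffusionMatrix_apply (G : SimpleGraph V) [DecidableRel G.Adj] (α : V → V → ℝ)
    {s : V → ℝ} (hs : ∀ i, s i ≠ 0) (i j : V) :
    diffusionMatrix G α s i j = (if i = j then 1 else 0) - laplacian G α i j / s j := by
  have hinv : (diagonal s)⁻¹ = diagonal fun i => (s i)⁻¹ := by
    refine inv_eq_left_inv ?_
    rw [diagonal_mul_diagonal, ← diagonal_one]
    congr 1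
    funext i
    exact inv_mul_cancel₀ (hs i)
  rw [diffusionMatrix, hinv, Matrix.sub_apply, mul_diagonal, one_apply, div_eq_mul_inv]

/-- The conjugate `S^(-1/2) M S^(1/2)` of the diffusion matrix `M`. -/
noncomputable def symmetrized (G : SimpleGraph V) [DecidableRel G.Adj] (α : V → V → ℝ)
    (s : V → ℝ) : Matrix V V ℝ :=
  of fun i j => (if i = j then 1 else 0) - laplacian G α i j / (√(s i) * √(s j))

theorem symmetrized_isHermitian (G : SimpleGraph V) [DecidableRel G.Adj]
    {α : V → V → ℝ} (hα : IsParameter G α) (s : V → ℝ) : (symmetrized G α s).IsHermitian := by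
  ext i j
  simp only [conjTranspose_apply, star_trivial, symmetrized, of_apply]
  rw [laplacian_isSymm G hα j i, mul_comm (√(s j))]
  simp only [eq_comm]

theorem sqrt_speed_pos {V : Type*} {s : V → ℝ} (hs : ∀ i, 1 ≤ s i) (i : V) : 0 < √(s i) :=
  Real.sqrt_pos.2 (by linarith [hs i])

/-- The similarity in a form free of inverses; it transfers both the spectrum and, through powers,
the rows. -/
theorem diffusionMatrix_mul_diagonal (G : SimpleGraph V) [DecidableRel G.Adj] (α : V → V → ℝ) {s : V → ℝ}
    (hs : ∀ i, 1 ≤ s i) :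
    diffusionMatrix G α s * diagonal (fun i => √(s i)) =
      diagonal (fun i => √(s i)) * symmetrized G α s := by
  ext i j
  rw [mul_diagonal, diagonal_mul, diffusionMatrix_apply G α (fun i => by linarith [hs i]),
    symmetrized, of_apply]
  have hi := sqrt_speed_pos hs i
  have hj := sqrt_speed_pos hs j
  have hsj : s j = √(s j) * √(s j) := (Real.mul_self_sqrt (by linarith [hs j])).symm
  rw [sub_mul, mul_sub]
  congr 1
  · split_ifs with h
    · rw [h]; ring
    · ring
  · rw [div_mul_eq_mul_div, mul_div_assoc', div_eq_div_iff (by linarith [hs j]) (by positivity)]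
    nth_rw 3 [hsj]
    ring

theorem charpoly_symmetrized (G : SimpleGraph V) [DecidableRel G.Adj] (α : V → V → ℝ) {s : V → ℝ}
    (hs : ∀ i, 1 ≤ s i) :
    (symmetrized G α s).charpoly = (diffusionMatrix G α s).charpoly := by
  have hne : ∀ i, √(s i) ≠ 0 := fun i => (sqrt_speed_pos hs i).ne'
  have h1 : diagonal (fun i => √(s i)) * diagonal (fun i => (√(s i))⁻¹) = 1 := by
    rw [diagonal_mul_diagonal, ← diagonal_one]
    congr 1
    funext i
    exact mul_inv_cancel₀ (hne i)
  have h2 : diffusionMatrix G α s = diagonal (fun i => √(s i)) *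
      (symmetrized G α s * diagonal (fun i => (√(s i))⁻¹)) := by
    rw [← Matrix.mul_assoc, ← diffusionMatrix_mul_diagonal G α hs, Matrix.mul_assoc, h1,
      Matrix.mul_one]
  have h3 : diagonal (fun i => (√(s i))⁻¹) * diagonal (fun i => √(s i)) = 1 :=
    mul_eq_one_comm.1 h1
  rw [h2, charpoly_mul_comm, Matrix.mul_assoc, h3, Matrix.mul_one]

theorem secondEigenvalue_symmetrized (G : SimpleGraph V) [DecidableRel G.Adj] (α : V → V → ℝ) {s : V → ℝ}
    (hs : ∀ i, 1 ≤ s i) :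
    secondEigenvalue (symmetrized G α s) = secondEigenvalue (diffusionMatrix G α s) := by
  rw [secondEigenvalue, secondEigenvalue, charpoly_symmetrized G α hs]

theorem one_sub_symmetrized_mulVec (G : SimpleGraph V) [DecidableRel G.Adj] (α : V → V → ℝ) {s : V → ℝ}
    (hs : ∀ i, 1 ≤ s i) (f : V → ℝ) (i : V) :
    ((1 - symmetrized G α s) *ᵥ fun j => √(s j) * f j) i =
      (laplacian G α *ᵥ f) i / √(s i) := by
  simp only [mulVec, dotProduct, symmetrized, Matrix.sub_apply, of_apply, one_apply, Finset.sum_div]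
  refine Finset.sum_congr rfl fun j _ => ?_
  have hi := sqrt_speed_pos hs i
  have hj := sqrt_speed_pos hs j
  field_simp
  ring

theorem symmetrized_mulVec_sqrt (G : SimpleGraph V) [DecidableRel G.Adj] (α : V → V → ℝ) {s : V → ℝ}
    (hs : ∀ i, 1 ≤ s i) :
    symmetrized G α s *ᵥ (fun i => √(s i)) = fun i => √(s i) := by
  have h : (1 - symmetrized G α s) *ᵥ (fun i => √(s i)) = 0 := by
    funext i
    have := one_sub_symmetrized_mulVec G α hs (fun _ => 1) i
    simpa [laplacian_mulVec] using this
  rw [sub_mulVec, one_mulVec, sub_eq_zero] at h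
  exact h.symm

/-- The substitution `v = √s * f` cancels the speeds, so the Dirichlet form of the symmetrized
matrix is half of the edge energy of `f`, whatever the speeds are. -/
theorem dirichlet_symmetrized (G : SimpleGraph V) [DecidableRel G.Adj]
    {α : V → V → ℝ} (hα : IsParameter G α) {s : V → ℝ}
    (hs : ∀ i, 1 ≤ s i) (f : V → ℝ) :
    2 * ((fun j => √(s j) * f j) ⬝ᵥ ((1 - symmetrized G α s) *ᵥ fun j => √(s j) * f j)) =
      energy G α f := by
  rw [← dotProduct_laplacian_mulVec G hα]
  congr 1
  refine Finset.sum_congr rfl fun i _ => ?_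
  rw [one_sub_symmetrized_mulVec G α hs]
  have hi := sqrt_speed_pos hs i
  field_simp

/-- The evolution of a row of the powers of the diffusion matrix, in symmetrized coordinates. -/
theorem symmetrized_pow_mulVec (G : SimpleGraph V) [DecidableRel G.Adj]
    {α : V → V → ℝ} (hα : IsParameter G α) {s : V → ℝ}
    (hs : ∀ i, 1 ≤ s i) (t : ℕ) (k : V) :
    (symmetrized G α s ^ t) *ᵥ (fun j => √(s j) * (Pi.single k 1 : V → ℝ) j) =
      fun i => √(s i) * (diffusionMatrix G α s ^ t) k i := by
  have hsc : SemiconjBy (diagonal fun i => √(s i)) (symmetrized G α s) (diffusionMatrix G α s) :=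
    (diffusionMatrix_mul_diagonal G α hs).symm
  have hpow := congrFun₂ (hsc.pow_right t).eq k
  have hsymm := (symmetrized_isHermitian G hα s).pow t
  funext i
  have hki := hpow i
  rw [diagonal_mul, mul_diagonal] at hki
  have hik : (symmetrized G α s ^ t) i k = (symmetrized G α s ^ t) k i := by
    simpa using (hsymm.apply i k).symm
  rw [mulVec, dotProduct, Finset.sum_eq_single k]
  · simp only [Pi.single_eq_same, mul_one]
    rw [hik]
    linarith
  · intro j _ hj
    simp [hj]
  · simp

end Diffusion

namespace Diffusion

open Matrix

variable {V : Type*} [Fintype V] [DecidableEq V]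

/-! ### The refined local divergence -/

theorem contLoad_eq_pow_mulVec (G : SimpleGraph V) [DecidableRel G.Adj] (α : V → V → ℝ)
    {s : V → ℝ} (hs : ∀ i, s i ≠ 0) (x₀ : V → ℝ) (t : ℕ) :
    contLoad G α s x₀ t = (diffusionMatrix G α s ^ t) *ᵥ x₀ := by
  induction t with
  | zero => simp [contLoad]
  | succ t ih => rw [contLoad_succ G α s hs, ih, mulVec_mulVec, pow_succ']

theorem contribution_eq (G : SimpleGraph V) [DecidableRel G.Adj] (α : V → V → ℝ)
    {s : V → ℝ} (hs : ∀ i, s i ≠ 0) (k i j : V) (t : ℕ) :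
    contribution G α s k i j t =
      (diffusionMatrix G α s ^ t) k i - (diffusionMatrix G α s ^ t) k j := by
  simp [contribution, contLoad_eq_pow_mulVec G α hs]

/-! ### Decay along the rows of the powers of the diffusion matrix -/

theorem sqrt_speed_ne_zero {V : Type*} {s : V → ℝ} (hs : ∀ i, 1 ≤ s i) (k : V) :
    (fun i => √(s i)) ≠ 0 := fun h => (sqrt_speed_pos hs k).ne' (congrFun h k)

/-- Simplicity of the eigenvalue `1` acts here as connectedness: zero energy makes `√s * f` a
multiple of `√s`. -/
theorem eq_of_energy_nonpos (G : SimpleGraph V) [DecidableRel G.Adj] {α : V → V → ℝ}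
    (hα : IsParameter G α) {s : V → ℝ} (hs : ∀ i, 1 ≤ s i)
    (hl : secondEigenvalue (diffusionMatrix G α s) < 1) {f : V → ℝ} (hf : energy G α f ≤ 0)
    (i j : V) : f i = f j := by
  rw [← secondEigenvalue_symmetrized G α hs] at hl
  rw [← dirichlet_symmetrized G hα hs] at hf
  obtain ⟨r, hr⟩ := exists_eq_smul_of_dirichlet_nonpos (symmetrized_isHermitian G hα s)
    (sqrt_speed_ne_zero hs i) (symmetrized_mulVec_sqrt G α hs) hl (by linarith)
  have h : ∀ k, f k = r := fun k => by
    have hk := congrFun hr k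
    simp only [Pi.smul_apply, smul_eq_mul] at hk
    exact mul_left_cancel₀ (sqrt_speed_pos hs k).ne' (by linarith)
  rw [h i, h j]

theorem energy_row_le (G : SimpleGraph V) [DecidableRel G.Adj] {α : V → V → ℝ}
    (hα : IsParameter G α) {s : V → ℝ} (hs : ∀ i, 1 ≤ s i)
    (hl : secondEigenvalue (diffusionMatrix G α s) < 1) (k : V) (t : ℕ) :
    energy G α ((diffusionMatrix G α s ^ t) k) ≤
      (secondEigenvalue (diffusionMatrix G α s) ^ t) ^ 2 *
        (2 * ∑ l ∈ G.neighborFinset k, α k l) := by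
  rw [← energy_single G hα, ← dirichlet_symmetrized G hα hs, ← dirichlet_symmetrized G hα hs,
    ← symmetrized_pow_mulVec G hα hs, ← secondEigenvalue_symmetrized G α hs]
  rw [← secondEigenvalue_symmetrized G α hs] at hl
  have := dirichlet_pow_mulVec_le (symmetrized_isHermitian G hα s) (sqrt_speed_ne_zero hs k)
    (symmetrized_mulVec_sqrt G α hs) hl
    (fun j => √(s j) * (Pi.single k 1 : V → ℝ) j) t
  linarith

theorem exists_sum_row_sub_sq_le (G : SimpleGraph V) [DecidableRel G.Adj] {α : V → V → ℝ}
    (hα : IsParameter G α) {s : V → ℝ} (hs : ∀ i, 1 ≤ s i)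
    (hl : secondEigenvalue (diffusionMatrix G α s) < 1) (k : V) (t : ℕ) :
    ∃ r : ℝ, ∑ i, s i * ((diffusionMatrix G α s ^ t) k i - r) ^ 2 ≤
      (secondEigenvalue (diffusionMatrix G α s) ^ t) ^ 2 * s k := by
  set u : V → ℝ := fun i => √(s i) with hu
  set v : V → ℝ := fun j => √(s j) * (Pi.single k 1 : V → ℝ) j with hv
  have hune : u ≠ 0 := sqrt_speed_ne_zero hs k
  have huu : u ⬝ᵥ u ≠ 0 := fun h => hune (dotProduct_self_eq_zero.1 h)
  have hNu : symmetrized G α s *ᵥ u = u := symmetrized_mulVec_sqrt G α hs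
  have hNtu : (symmetrized G α s ^ t) *ᵥ u = u := by
    induction t with
    | zero => simp
    | succ t ih => rw [pow_succ, ← mulVec_mulVec, hNu, ih]
  -- `r` is the coefficient of the orthogonal projection of `v` onto `u`. All powers fix `u`, so
  -- subtracting `r • u` commutes with the evolution.
  set r : ℝ := v ⬝ᵥ u / (u ⬝ᵥ u) with hr
  have horth : (v - r • u) ⬝ᵥ u = 0 := by
    rw [sub_dotProduct, smul_dotProduct, smul_eq_mul, hr, div_mul_cancel₀ _ huu, sub_self]
  rw [← secondEigenvalue_symmetrized G α hs] at hl ⊢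
  have h := dotProduct_pow_mulVec_le (symmetrized_isHermitian G hα s) hune hNu hl horth t
  rw [mulVec_sub, mulVec_smul, hNtu, hv, symmetrized_pow_mulVec G hα hs, ← hv] at h
  refine ⟨r, le_trans (le_of_eq ?_) (h.trans ?_)⟩
  · refine Finset.sum_congr rfl fun i _ => ?_
    have hsi : √(s i) * √(s i) = s i := Real.mul_self_sqrt (by linarith [hs i])
    simp only [Pi.sub_apply, Pi.smul_apply, smul_eq_mul, hu]
    linear_combination (-((diffusionMatrix G α s ^ t) k i - r) ^ 2) * hsi
  · refine mul_le_mul_of_nonneg_left ?_ (sq_nonneg _)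
    have hvv : v ⬝ᵥ v = s k := by
      rw [dotProduct, Finset.sum_eq_single k]
      · simp only [hv, Pi.single_eq_same, mul_one]
        exact Real.mul_self_sqrt (by linarith [hs k])
      · intro j _ hj
        simp [hv, hj]
      · simp
    -- Pythagoras: removing the projection can only decrease the squared norm `s k`.
    have hsub : (v - r • u) ⬝ᵥ (v - r • u) = v ⬝ᵥ v - r ^ 2 * (u ⬝ᵥ u) := by
      have hvu : v ⬝ᵥ u = r * (u ⬝ᵥ u) := by rw [hr, div_mul_cancel₀ _ huu]
      rw [dotProduct_sub, dotProduct_smul, horth, sub_dotProduct, smul_dotProduct,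
        dotProduct_comm u v, hvu, smul_eq_mul, smul_eq_mul]
      ring
    rw [hsub, hvv]
    have : 0 ≤ u ⬝ᵥ u := Finset.sum_nonneg fun i _ => mul_self_nonneg (u i)
    nlinarith [mul_nonneg (sq_nonneg r) this]

/-- With equal speeds the common speed cancels from the variance bound. In the other case the
weighted degree of `k` bounds the initial energy and also, up to `κ / d`, every edge weight from
below, so it cancels as well. -/
theorem gradientSq_row_le (G : SimpleGraph V) [DecidableRel G.Adj] {α : V → V → ℝ}
    (hα : IsParameter G α) {s : V → ℝ} (hs : ∀ i, 1 ≤ s i) {κ : ℝ} (hκ : 0 < κ)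
    (hcase : (∀ i j, s i = s j) ∨ ∀ i j k, G.Adj i j →
      κ * ∑ l ∈ G.neighborFinset k, α k l ≤ (G.maxDegree : ℝ) * α i j)
    (hl : secondEigenvalue (diffusionMatrix G α s) < 1) (k : V) (t : ℕ) :
    gradientSq G ((diffusionMatrix G α s ^ t) k) ≤
      (4 + 2 / κ) * G.maxDegree * (secondEigenvalue (diffusionMatrix G α s) ^ t) ^ 2 := by
  set l := secondEigenvalue (diffusionMatrix G α s) with hldef
  have hd : (0 : ℝ) ≤ G.maxDegree := Nat.cast_nonneg _
  have hl2 : 0 ≤ (l ^ t) ^ 2 := sq_nonneg _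
  rcases hcase with heq | hcase
  · obtain ⟨r, hr⟩ := exists_sum_row_sub_sq_le G hα hs hl k t
    rw [← hldef, Finset.sum_congr rfl fun i _ => by rw [heq i k], ← Finset.mul_sum, mul_comm] at hr
    have hr' := le_of_mul_le_mul_right hr (by linarith [hs k])
    refine (gradientSq_le G _ r).trans ?_
    have h1 := mul_le_mul_of_nonneg_left hr' (mul_nonneg (by norm_num : (0 : ℝ) ≤ 4) hd)
    have h2 : 0 ≤ 2 / κ * (G.maxDegree * (l ^ t) ^ 2) := by positivity
    linarith
  · set A := ∑ l ∈ G.neighborFinset k, α k l with hA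
    have hA0 : 0 ≤ A := Finset.sum_nonneg fun j hj =>
      hα.nonneg k j ((G.mem_neighborFinset k j).1 hj)
    have hE := energy_row_le G hα hs hl k t
    rw [← hldef, ← hA] at hE
    rcases hA0.eq_or_lt with h0 | hpos
    -- Nothing can be cancelled if the weighted degree is zero, but then the energy vanishes and the
    -- row is constant.
    · rw [← h0, mul_zero, mul_zero] at hE
      rw [gradientSq_const G (eq_of_energy_nonpos G hα hs hl hE)]
      positivity
    · have h1 := gradientSq_le_energy G α (fun i j hij => hcase i j k hij)
        ((diffusionMatrix G α s ^ t) k)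
      have h2 : κ * A * gradientSq G ((diffusionMatrix G α s ^ t) k) ≤
          κ * A * (2 / κ * G.maxDegree * (l ^ t) ^ 2) := by
        refine h1.trans ((mul_le_mul_of_nonneg_left hE hd).trans (le_of_eq ?_))
        field_simp
      have h3 := le_of_mul_le_mul_left h2 (mul_pos hκ hpos)
      have h4 : 0 ≤ G.maxDegree * (l ^ t) ^ 2 := by positivity
      linarith

theorem sum_gradientSq_row_le (G : SimpleGraph V) [DecidableRel G.Adj] {α : V → V → ℝ}
    (hα : IsParameter G α) {s : V → ℝ} (hs : ∀ i, 1 ≤ s i) {κ : ℝ} (hκ : 0 < κ)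
    (hcase : (∀ i j, s i = s j) ∨ ∀ i j k, G.Adj i j →
      κ * ∑ l ∈ G.neighborFinset k, α k l ≤ (G.maxDegree : ℝ) * α i j)
    (hl : secondEigenvalue (diffusionMatrix G α s) < 1) (k : V) (T : ℕ) :
    ∑ t ∈ Finset.range T, gradientSq G ((diffusionMatrix G α s ^ t) k) ≤
      (4 + 2 / κ) * G.maxDegree / (1 - secondEigenvalue (diffusionMatrix G α s)) := by
  have h0 := secondEigenvalue_nonneg (diffusionMatrix G α s)
  have hc : 0 ≤ (4 + 2 / κ) * (G.maxDegree : ℝ) := by positivity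
  have hterm : ∀ t, gradientSq G ((diffusionMatrix G α s ^ t) k) ≤
      (4 + 2 / κ) * G.maxDegree * secondEigenvalue (diffusionMatrix G α s) ^ t := fun t => by
    -- Weakening `λ ^ (2 * t)` to `λ ^ t` leaves a plain geometric series in `λ`.
    refine (gradientSq_row_le G hα hs hκ hcase hl k t).trans (mul_le_mul_of_nonneg_left ?_ hc)
    have h1 := pow_nonneg h0 t
    have h2 := pow_le_one₀ h0 hl.le (n := t)
    nlinarith
  refine (Finset.sum_le_sum fun t _ => hterm t).trans ?_
  rw [← Finset.mul_sum, le_div_iff₀ (by linarith), mul_assoc,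
    mul_comm (∑ i ∈ _, _), mul_neg_geom_sum]
  exact mul_le_of_le_one_right hc (by linarith [pow_nonneg h0 T])

/-- The maximum over the neighbors of `i` is at most the sum over them, which turns the inner sum
into `gradientSq` of row `k`. -/
theorem refinedLocalDivergence_le (G : SimpleGraph V) [DecidableRel G.Adj] {α : V → V → ℝ}
    {s : V → ℝ} (hs : ∀ i, s i ≠ 0) {B : ℝ}
    (hB : ∀ k T, ∑ t ∈ Finset.range T, gradientSq G ((diffusionMatrix G α s ^ t) k) ≤ B) :
    refinedLocalDivergence G α s ≤ ENNReal.ofReal √B := by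
  refine iSup_le fun k => ?_
  have hB0 : 0 ≤ B := by simpa using hB k 0
  rw [Real.sqrt_eq_rpow, ← ENNReal.ofReal_rpow_of_nonneg hB0 (by norm_num)]
  refine ENNReal.rpow_le_rpow (ENNReal.tsum_le_of_sum_range_le fun T => ?_) (by norm_num)
  refine le_trans ?_ (ENNReal.ofReal_le_ofReal (hB k T))
  have hnn : ∀ t, ∀ i ∈ Finset.univ, 0 ≤ ∑ j ∈ G.neighborFinset i,
      ((diffusionMatrix G α s ^ t) k i - (diffusionMatrix G α s ^ t) k j) ^ 2 :=
    fun t i _ => Finset.sum_nonneg fun j _ => sq_nonneg _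
  have hnn' : ∀ t ∈ Finset.range T, 0 ≤ gradientSq G ((diffusionMatrix G α s ^ t) k) :=
    fun t _ => Finset.sum_nonneg (hnn t)
  rw [ENNReal.ofReal_sum_of_nonneg hnn']
  refine Finset.sum_le_sum fun t _ => ?_
  rw [gradientSq, ENNReal.ofReal_sum_of_nonneg (hnn t)]
  refine Finset.sum_le_sum fun i _ => iSup₂_le fun j hij => ENNReal.ofReal_le_ofReal ?_
  rw [contribution_eq G α hs]
  exact Finset.single_le_sum (f := fun j => ((diffusionMatrix G α s ^ t) k i -
    (diffusionMatrix G α s ^ t) k j) ^ 2) (fun j _ => sq_nonneg _)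
    ((G.mem_neighborFinset i j).2 hij)

end Diffusion

namespace Diffusion

open Matrix

/-! ### Expectations over discrete distributions -/

theorem tsum_bind_mul {β γ : Type*} (p : PMF β) (q : β → PMF γ) (f : γ → ENNReal) :
    ∑' y, (p.bind q) y * f y = ∑' x, p x * ∑' y, q x y * f y := by
  simp only [PMF.bind_apply, ← ENNReal.tsum_mul_right, ← ENNReal.tsum_mul_left]
  rw [ENNReal.tsum_comm]
  simp only [mul_assoc]

theorem tsum_map_mul {β γ : Type*} (p : PMF β) (h : β → γ) (f : γ → ENNReal) :
    ∑' y, (p.map h) y * f y = ∑' x, p x * f (h x) := by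
  rw [PMF.map, tsum_bind_mul]
  refine tsum_congr fun x => ?_
  congr 1
  rw [tsum_eq_single (h x)]
  · simp
  · intro y hy
    simp [hy]

theorem sum_independent_mul_prod {ι : Type*} [Fintype ι] [DecidableEq ι] {β : ι → Type*}
    [∀ i, Fintype (β i)] (p : ∀ i, PMF (β i)) (f : ∀ i, β i → ENNReal) :
    ∑ ω, independent p ω * ∏ i, f i (ω i) = ∏ i, ∑ b, p i b * f i b := by
  rw [Finset.prod_univ_sum, Fintype.piFinset_univ]
  refine Finset.sum_congr rfl fun ω _ => ?_
  rw [independent, PMF.ofFintype_apply, Finset.prod_mul_distrib]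

theorem independent_ne_zero {ι : Type*} [Fintype ι] [DecidableEq ι] {β : ι → Type*}
    [∀ i, Fintype (β i)] {p : ∀ i, PMF (β i)} {ω : ∀ i, β i} (h : independent p ω ≠ 0) (i : ι) :
    p i (ω i) ≠ 0 := by
  rw [independent, PMF.ofFintype_apply] at h
  exact Finset.prod_ne_zero_iff.1 h i (Finset.mem_univ i)

/-- Hoeffding's lemma for a distribution on a finite type. -/
theorem sum_mul_exp_sub_mean_le {β : Type*} [Fintype β] (p : PMF β) (h : β → ℝ) (x m : ℝ)
    (hm : ∀ b, p b ≠ 0 → |h b - x| ≤ m) :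
    ∑ b, p b * ENNReal.ofReal (Real.exp (h b - ∑ w, (p w).toReal * h w)) ≤
      ENNReal.ofReal (Real.exp (m ^ 2 / 2)) := by
  let _ : MeasurableSpace β := ⊤
  have hae : ∀ᵐ b ∂p.toMeasure, h b ∈ Set.Icc (x - m) (x + m) := by
    rw [MeasureTheory.ae_iff, PMF.toMeasure_apply_eq_zero_iff _ MeasurableSpace.measurableSet_top, Set.disjoint_left]
    intro b hb hb'
    have := abs_le.1 (hm b ((PMF.mem_support_iff _ _).1 hb))
    exact hb' ⟨by linarith, by linarith⟩
  have hsub := (ProbabilityTheory.hasSubgaussianMGF_of_mem_Icc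
    (measurable_from_top (f := h)).aemeasurable hae).mgf_le 1
  rw [ProbabilityTheory.mgf, PMF.integral_eq_sum, PMF.integral_eq_sum] at hsub
  simp only [smul_eq_mul, one_mul] at hsub
  -- The interval has length `2 * m`, so the variance proxy is `m ^ 2`.
  have hc : (((‖x + m - (x - m)‖₊ / 2) ^ 2 : NNReal) : ℝ) * 1 ^ 2 / 2 = m ^ 2 / 2 := by
    push_cast
    rw [Real.norm_eq_abs, div_pow, sq_abs]
    ring
  rw [hc] at hsub
  refine le_trans (le_of_eq ?_) (ENNReal.ofReal_le_ofReal hsub)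
  rw [ENNReal.ofReal_sum_of_nonneg fun b _ => by positivity]
  refine Finset.sum_congr rfl fun b _ => ?_
  rw [ENNReal.ofReal_mul ENNReal.toReal_nonneg, ENNReal.ofReal_toReal (p.apply_ne_top b)]

/-! ### One round of randomized rounding -/

variable {V : Type*} [Fintype V]

theorem fract_le_excess {G : SimpleGraph V} [DecidableRel G.Adj] {Y : V → V → ℝ} {i j : V}
    (hij : G.Adj i j) (hY : 0 ≤ Y i j) : Int.fract (Y i j) ≤ excess G Y i := by
  have h := Finset.single_le_sum
    (f := fun j => if 0 ≤ Y i j then Int.fract (Y i j) else 0) (s := G.neighborFinset i)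
    (fun j _ => by
      split_ifs
      · exact Int.fract_nonneg _
      · exact le_rfl) ((G.mem_neighborFinset i j).2 hij)
  rwa [if_pos hY] at h

theorem ceil_excess_le (G : SimpleGraph V) [DecidableRel G.Adj] (Y : V → V → ℝ) (i : V) :
    ⌈excess G Y i⌉₊ ≤ G.maxDegree := by
  refine (Nat.ceil_le.2 ?_).trans (G.degree_le_maxDegree i)
  have h : excess G Y i ≤ ∑ j ∈ G.neighborFinset i, (1 : ℝ) :=
    Finset.sum_le_sum fun j _ => by
      split_ifs
      · exact (Int.fract_lt_one _).le
      · exact zero_le_one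
  simpa using h

variable [DecidableEq V]

theorem tokenPMF_toReal (G : SimpleGraph V) [DecidableRel G.Adj] (Y : V → V → ℝ) (i j : V) :
    (tokenPMF G Y i j).toReal = tokenProb G Y i j := by
  rw [tokenPMF, PMF.ofFintype_apply, ENNReal.toReal_ofReal (tokenProb_nonneg G Y i j)]

theorem tokenProb_ne_zero {G : SimpleGraph V} [DecidableRel G.Adj] {Y : V → V → ℝ} {i j : V}
    (h : tokenProb G Y i j ≠ 0) : j = i ∨ G.Adj i j ∧ 0 ≤ Y i j ∧ Int.fract (Y i j) ≠ 0 := by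
  by_contra! hc
  refine h ?_
  rw [tokenProb, if_neg hc.1]
  split_ifs with h'
  · rw [hc.2 h'.1 h'.2, zero_div, mul_zero]
  · rfl

theorem tokenPMF_ne_zero {G : SimpleGraph V} [DecidableRel G.Adj] {Y : V → V → ℝ} {i j : V}
    (h : tokenPMF G Y i j ≠ 0) : tokenProb G Y i j ≠ 0 := fun h0 => h (by
  rw [tokenPMF, PMF.ofFintype_apply, h0, ENNReal.ofReal_zero])

/-- The expected number of tokens sent along an edge is the fractional part of the scheduled flow,
so the rounding is unbiased. If the excess is zero, so is the fractional part. -/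
theorem ceil_excess_mul_tokenProb {G : SimpleGraph V} [DecidableRel G.Adj] {Y : V → V → ℝ}
    {i j : V} (hij : G.Adj i j) :
    (⌈excess G Y i⌉₊ : ℝ) * tokenProb G Y i j = if 0 ≤ Y i j then Int.fract (Y i j) else 0 := by
  rw [tokenProb, if_neg hij.ne']
  by_cases hY : 0 ≤ Y i j
  · rw [if_pos ⟨hij, hY⟩, if_pos hY]
    have hle := fract_le_excess hij hY
    rcases (excess_nonneg G Y i).eq_or_lt with h0 | hpos
    · rw [← h0] at hle
      have : Int.fract (Y i j) = 0 := le_antisymm hle (Int.fract_nonneg _)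
      rw [this]
      simp
    · have : (0 : ℝ) < ⌈excess G Y i⌉₊ := Nat.cast_pos.2 (Nat.ceil_pos.2 hpos)
      field_simp
  · rw [if_neg fun h => hY h.2, if_neg hY, mul_zero]

/-- The rounding error on the edge from `i` to `j`, charged to `i`. -/
noncomputable def roundingError (Y : V → V → ℝ) {T : V → ℕ} (ω : ∀ i, Fin (T i) → V) (i j : V) :
    ℝ :=
  if 0 ≤ Y i j then Int.fract (Y i j) - (Finset.univ.filter fun b => ω i b = j).card else 0

theorem sub_roundedFlow {G : SimpleGraph V} [DecidableRel G.Adj] {Y : V → V → ℝ}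
    (hY : ∀ i j, Y i j = -Y j i) {ω : Destinations G Y}
    (hω : ∀ i b, tokenProb G Y i (ω i b) ≠ 0) {i j : V} (hij : G.Adj i j) :
    Y i j - roundedFlow G Y ω i j = roundingError Y ω i j - roundingError Y ω j i := by
  have hji := hY j i
  rcases lt_trichotomy (Y i j) 0 with hlt | h0 | hgt
  · rw [roundedFlow, roundingError, roundingError, if_neg hlt.not_ge, if_neg hlt.not_ge,
      if_pos (by linarith), ← Int.self_sub_floor]
    push_cast
    linarith
  -- An edge with zero flow counts as outgoing at both ends. Both errors vanish, since no token uses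
  -- such an edge with positive probability.
  · have hcount : ∀ i j : V, G.Adj i j → Y i j = 0 →
        (Finset.univ.filter fun b => ω i b = j).card = 0 := by
      intro i j hij h
      rw [Finset.card_eq_zero, Finset.filter_eq_empty_iff]
      rintro b - rfl
      rcases tokenProb_ne_zero (hω i b) with h' | h'
      · exact hij.ne' h'
      · exact h'.2.2 (by rw [h, Int.fract_zero])
    have h0' : Y j i = 0 := by linarith
    rw [roundedFlow, roundingError, roundingError, h0, h0', if_pos le_rfl, if_pos le_rfl,
      hcount i j hij h0, hcount j i hij.symm h0']
    simp
  · rw [roundedFlow, roundingError, roundingError, if_pos hgt.le, if_pos hgt.le,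
      if_neg (by linarith), ← Int.self_sub_floor]
    push_cast
    linarith

/-- Measure `g` relative to `g i`, so that tokens staying at `i` drop out; grouping the others by
destination leaves token counts minus their expectations. -/
theorem sum_tokens_eq {G : SimpleGraph V} [DecidableRel G.Adj] {Y : V → V → ℝ}
    {ω : Destinations G Y} (hω : ∀ i b, tokenProb G Y i (ω i b) ≠ 0) (g : V → ℝ) (i : V) :
    ∑ b, (g (ω i b) - ∑ j, tokenProb G Y i j * g j) =
      ∑ j ∈ G.neighborFinset i, roundingError Y ω i j * (g i - g j) := by
  have hrestrict : ∀ F : V → ℝ, (∀ j, j ≠ i → ¬ G.Adj i j → F j = 0) →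
      ∑ j, F j * (g j - g i) = ∑ j ∈ G.neighborFinset i, F j * (g j - g i) := fun F hF => by
    symm
    refine Finset.sum_subset (Finset.subset_univ _) fun j _ hj => ?_
    rw [SimpleGraph.mem_neighborFinset] at hj
    by_cases hji : j = i
    · rw [hji, sub_self, mul_zero]
    · rw [hF j hji hj, zero_mul]
  have hmean : ∑ j, tokenProb G Y i j * g j - g i =
      ∑ j ∈ G.neighborFinset i, tokenProb G Y i j * (g j - g i) := by
    rw [← hrestrict]
    · simp only [mul_sub, Finset.sum_sub_distrib, ← Finset.sum_mul, sum_tokenProb, one_mul]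
    · intro j hji hj
      by_contra h
      rcases tokenProb_ne_zero h with h' | h'
      · exact hji h'
      · exact hj h'.1
  have hcount : ∑ b, (g (ω i b) - g i) = ∑ j ∈ G.neighborFinset i,
      ((Finset.univ.filter fun b => ω i b = j).card : ℝ) * (g j - g i) := by
    rw [← hrestrict fun j => ((Finset.univ.filter fun b => ω i b = j).card : ℝ)]
    · rw [← Finset.sum_fiberwise Finset.univ (fun b => ω i b)]
      refine Finset.sum_congr rfl fun j _ => ?_
      rw [Finset.sum_congr rfl fun b hb => by rw [(Finset.mem_filter.1 hb).2], Finset.sum_const,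
        nsmul_eq_mul]
    · intro j hji hj
      rw [Nat.cast_eq_zero, Finset.card_eq_zero, Finset.filter_eq_empty_iff]
      rintro b - rfl
      rcases tokenProb_ne_zero (hω i b) with h' | h'
      · exact hji h'
      · exact hj h'.1
  have hsplit : ∑ b, (g (ω i b) - ∑ j, tokenProb G Y i j * g j) =
      ∑ b, (g (ω i b) - g i) -
        ⌈excess G Y i⌉₊ * (∑ j, tokenProb G Y i j * g j - g i) := by
    simp only [Finset.sum_sub_distrib, Finset.sum_const, Finset.card_univ, Fintype.card_fin,
      nsmul_eq_mul]
    ring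
  rw [hsplit, hmean, hcount, Finset.mul_sum, ← Finset.sum_sub_distrib]
  refine Finset.sum_congr rfl fun j hj => ?_
  have hij := (G.mem_neighborFinset i j).1 hj
  rw [← mul_assoc, ceil_excess_mul_tokenProb hij, roundingError]
  split_ifs with hYij
  · ring
  · have : (Finset.univ.filter fun b => ω i b = j).card = 0 := by
      rw [Finset.card_eq_zero, Finset.filter_eq_empty_iff]
      rintro b - rfl
      rcases tokenProb_ne_zero (hω i b) with h' | h'
      · exact hij.ne' h'
      · exact hYij h'.2.1
    rw [this]
    simp

/-- The total deviation caused by rounding, tested against `g`, as a sum over all tokens. -/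
theorem sum_rounding_eq_sum_tokens {G : SimpleGraph V} [DecidableRel G.Adj] {Y : V → V → ℝ}
    (hY : ∀ i j, Y i j = -Y j i) {ω : Destinations G Y}
    (hω : ∀ i b, tokenProb G Y i (ω i b) ≠ 0) (g : V → ℝ) :
    ∑ i, g i * ∑ j ∈ G.neighborFinset i, (Y i j - roundedFlow G Y ω i j) =
      ∑ i, ∑ b, (g (ω i b) - ∑ j, tokenProb G Y i j * g j) := by
  simp only [sum_tokens_eq hω]
  have h : ∀ i, ∑ j ∈ G.neighborFinset i, (Y i j - roundedFlow G Y ω i j) =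
      ∑ j ∈ G.neighborFinset i, (roundingError Y ω i j - roundingError Y ω j i) := fun i =>
    Finset.sum_congr rfl fun j hj => sub_roundedFlow hY hω ((G.mem_neighborFinset i j).1 hj)
  simp only [h, Finset.sum_sub_distrib, mul_sub, Finset.mul_sum]
  rw [sum_neighborFinset_comm G fun i j => g i * roundingError Y ω j i]
  congr 1 <;> exact Finset.sum_congr rfl fun i _ => Finset.sum_congr rfl fun j _ => mul_comm _ _

/-- Independence factors the exponential moment over tokens. Hoeffding's lemma costs half of the
local gradient at `i` per token, and `i` has at most `d` tokens. -/
theorem sum_destinationsPMF_mul_exp_le {G : SimpleGraph V} [DecidableRel G.Adj] {Y : V → V → ℝ}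
    (hY : ∀ i j, Y i j = -Y j i) (g : V → ℝ) :
    ∑ ω, destinationsPMF G Y ω * ENNReal.ofReal (Real.exp
      (∑ i, g i * ∑ j ∈ G.neighborFinset i, (Y i j - roundedFlow G Y ω i j))) ≤
      ENNReal.ofReal (Real.exp (G.maxDegree / 2 * gradientSq G g)) := by
  have hrw : ∀ ω, destinationsPMF G Y ω * ENNReal.ofReal (Real.exp
      (∑ i, g i * ∑ j ∈ G.neighborFinset i, (Y i j - roundedFlow G Y ω i j))) =
      destinationsPMF G Y ω * ∏ i, ∏ b, ENNReal.ofReal (Real.exp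
        (g (ω i b) - ∑ j, (tokenPMF G Y i j).toReal * g j)) := fun ω => by
    -- The decomposition into tokens is valid only for outcomes of positive probability; the others
    -- carry no weight.
    by_cases h0 : destinationsPMF G Y ω = 0
    · rw [h0, zero_mul, zero_mul]
    · have hω : ∀ i b, tokenProb G Y i (ω i b) ≠ 0 := fun i b =>
        tokenPMF_ne_zero (independent_ne_zero (independent_ne_zero h0 i) b)
      rw [sum_rounding_eq_sum_tokens hY hω, Real.exp_sum,
        ENNReal.ofReal_prod_of_nonneg fun i _ => (Real.exp_pos _).le]
      congr 1
      refine Finset.prod_congr rfl fun i _ => ?_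
      rw [Real.exp_sum, ENNReal.ofReal_prod_of_nonneg fun i _ => (Real.exp_pos _).le]
      simp only [tokenPMF_toReal]
  rw [Finset.sum_congr rfl fun ω _ => hrw ω, destinationsPMF,
    sum_independent_mul_prod (β := fun i => Fin ⌈excess G Y i⌉₊ → V)
      (fun i => independent fun _ => tokenPMF G Y i) fun i ν => ∏ b, ENNReal.ofReal (Real.exp
        (g (ν b) - ∑ j, (tokenPMF G Y i j).toReal * g j)), gradientSq, Finset.mul_sum, Real.exp_sum,
    ENNReal.ofReal_prod_of_nonneg fun i _ => (Real.exp_pos _).le]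
  refine Finset.prod_le_prod' fun i _ => ?_
  rw [sum_independent_mul_prod _ fun _ v => ENNReal.ofReal (Real.exp
        (g v - ∑ j, (tokenPMF G Y i j).toReal * g j))]
  set D := ∑ j ∈ G.neighborFinset i, (g i - g j) ^ 2 with hD
  have hD0 : 0 ≤ D := Finset.sum_nonneg fun j _ => sq_nonneg _
  have htoken := sum_mul_exp_sub_mean_le (tokenPMF G Y i) g (g i) √D fun v hv => by
    rcases tokenProb_ne_zero (tokenPMF_ne_zero hv) with rfl | h
    · simp
    · refine Real.abs_le_sqrt ?_
      rw [← neg_sq, neg_sub]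
      exact Finset.single_le_sum (f := fun j => (g i - g j) ^ 2) (fun j _ => sq_nonneg _)
        ((G.mem_neighborFinset i v).2 h.1)
  rw [Real.sq_sqrt hD0] at htoken
  refine (Finset.prod_le_prod' fun _ _ => htoken).trans ?_
  rw [Finset.prod_const, Finset.card_univ, Fintype.card_fin,
    ← ENNReal.ofReal_pow (Real.exp_pos _).le, ← Real.exp_nat_mul]
  refine ENNReal.ofReal_le_ofReal (Real.exp_le_exp.2 ?_)
  have hceil : (⌈excess G Y i⌉₊ : ℝ) ≤ G.maxDegree := by exact_mod_cast ceil_excess_le G Y i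
  nlinarith [mul_le_mul_of_nonneg_right hceil hD0]

end Diffusion

namespace Diffusion

open Matrix

/-! ### The deviation between the discrete and the continuous scheme -/

theorem flow_antisymm {V : Type*} [Fintype V] (G : SimpleGraph V) [DecidableRel G.Adj]
    {α : V → V → ℝ}
    (hα : IsParameter G α) (s x : V → ℝ) (i j : V) :
    flow G α s x i j = -flow G α s x j i := by
  unfold flow
  by_cases h : G.Adj i j
  · rw [if_pos h, if_pos h.symm, hα.symm i j h]
    ring
  · rw [if_neg h, if_neg fun h' => h h'.symm, neg_zero]

variable {V : Type*} [Fintype V] [DecidableEq V]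

/-- The new error splits as `X' - M x = (X' - M X) + M (X - x)`: fresh rounding noise plus the
transported old error, whose pairing with `g` is that of `g ᵥ* M` with `X - x`. -/
theorem tsum_discreteStep_mul_exp_le (G : SimpleGraph V) [DecidableRel G.Adj] {α : V → V → ℝ}
    (hα : IsParameter G α) {s : V → ℝ} (hs : ∀ i, s i ≠ 0) (g : V → ℝ) (X : V → ℤ) (x : V → ℝ) :
    ∑' X', discreteStep G α s X X' * ENNReal.ofReal (Real.exp
      (g ⬝ᵥ ((fun i => (X' i : ℝ)) - diffusionMatrix G α s *ᵥ x))) ≤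
      ENNReal.ofReal (Real.exp (G.maxDegree / 2 * gradientSq G g)) *
        ENNReal.ofReal (Real.exp
          ((g ᵥ* diffusionMatrix G α s) ⬝ᵥ ((fun i => (X i : ℝ)) - x))) := by
  have hMX : diffusionMatrix G α s *ᵥ (fun i => (X i : ℝ)) =
      fun i => (X i : ℝ) - ∑ j ∈ G.neighborFinset i, flow G α s (fun i => (X i : ℝ)) i j :=
    (contLoad_succ G α s hs (fun i => (X i : ℝ)) 0).symm
  rw [discreteStep, tsum_map_mul, tsum_fintype]
  refine le_trans (le_of_eq ?_) (mul_le_mul_left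
    (sum_destinationsPMF_mul_exp_le (flow_antisymm G hα s fun i => (X i : ℝ)) g) _)
  rw [Finset.sum_mul]
  refine Finset.sum_congr rfl fun ω _ => ?_
  rw [mul_assoc, ← ENNReal.ofReal_mul (Real.exp_pos _).le, ← Real.exp_add]
  congr 3
  rw [← dotProduct_mulVec, mulVec_sub, hMX]
  change _ = g ⬝ᵥ (fun i => ∑ j ∈ G.neighborFinset i, (flow G α s (fun i => (X i : ℝ)) i j -
    roundedFlow G (flow G α s fun i => (X i : ℝ)) ω i j)) + _
  rw [← dotProduct_add]
  congr 1
  funext i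
  simp only [Pi.add_apply, Pi.sub_apply, Finset.sum_sub_distrib]
  push_cast
  ring

theorem tsum_discreteLoad_mul_exp_le (G : SimpleGraph V) [DecidableRel G.Adj] {α : V → V → ℝ}
    (hα : IsParameter G α) {s : V → ℝ} (hs : ∀ i, s i ≠ 0) (x₀ : V → ℤ) (t : ℕ) (g : V → ℝ) :
    ∑' X, discreteLoad G α s x₀ t X * ENNReal.ofReal (Real.exp
      (g ⬝ᵥ ((fun i => (X i : ℝ)) - contLoad G α s (fun i => (x₀ i : ℝ)) t))) ≤
      ENNReal.ofReal (Real.exp (G.maxDegree / 2 *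
        ∑ τ ∈ Finset.range t, gradientSq G (g ᵥ* diffusionMatrix G α s ^ τ))) := by
  induction t generalizing g with
  | zero =>
    rw [tsum_eq_single x₀]
    · have : ((fun i => (x₀ i : ℝ)) - contLoad G α s (fun i => (x₀ i : ℝ)) 0) = 0 := sub_self _
      rw [this]
      simp [discreteLoad]
    · intro X hX
      simp [discreteLoad, hX]
  | succ t ih =>
    rw [discreteLoad, tsum_bind_mul, contLoad_succ G α s hs]
    refine (ENNReal.tsum_le_tsum fun X => mul_le_mul_right
      (tsum_discreteStep_mul_exp_le G hα hs g X _) _).trans ?_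
    simp only [mul_left_comm _ (ENNReal.ofReal (Real.exp (G.maxDegree / 2 * gradientSq G g)))]
    rw [ENNReal.tsum_mul_left]
    -- The induction hypothesis is used for `g ᵥ* M`, which shifts the powers by one; the current
    -- round supplies the term with exponent `0`.
    refine (mul_le_mul_right (ih _) _).trans (le_of_eq ?_)
    rw [← ENNReal.ofReal_mul (Real.exp_pos _).le, ← Real.exp_add, ← mul_add,
      Finset.sum_range_succ', add_comm]
    simp only [vecMul_vecMul, ← pow_succ', pow_zero, vecMul_one]

/-- Testing against `θ` times the unit vector of `k` makes the vectors `g ᵥ* M ^ τ` multiples of row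
`k`, so the bound on the divergence also controls the variance proxy. -/
theorem tsum_discreteLoad_mul_exp_coord_le (G : SimpleGraph V) [DecidableRel G.Adj]
    {α : V → V → ℝ} (hα : IsParameter G α) {s : V → ℝ} (hs : ∀ i, s i ≠ 0) (x₀ : V → ℤ) (t : ℕ)
    {B : ℝ} {k : V}
    (hB : ∑ τ ∈ Finset.range t, gradientSq G ((diffusionMatrix G α s ^ τ) k) ≤ B) (θ : ℝ) :
    ∑' X, discreteLoad G α s x₀ t X * ENNReal.ofReal (Real.exp
      (θ * (X k - contLoad G α s (fun i => (x₀ i : ℝ)) t k))) ≤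
      ENNReal.ofReal (Real.exp (θ ^ 2 * (G.maxDegree * B) / 2)) := by
  have h := tsum_discreteLoad_mul_exp_le G hα hs x₀ t (θ • Pi.single k 1)
  have hrow : ∀ τ, gradientSq G ((θ • Pi.single k 1 : V → ℝ) ᵥ* diffusionMatrix G α s ^ τ) =
      θ ^ 2 * gradientSq G ((diffusionMatrix G α s ^ τ) k) := fun τ => by
    rw [smul_vecMul, single_one_vecMul, gradientSq_smul]
    rfl
  simp only [smul_dotProduct, single_one_dotProduct, Pi.sub_apply, smul_eq_mul, hrow,
    ← Finset.mul_sum] at h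
  refine h.trans (ENNReal.ofReal_le_ofReal (Real.exp_le_exp.2 ?_))
  have h1 := mul_le_mul_of_nonneg_left hB (by positivity : 0 ≤ θ ^ 2 * (G.maxDegree : ℝ))
  linarith

/-- Concentration of the discrete scheme around the continuous one, uniformly over the nodes. -/
theorem toMeasure_deviation_le (G : SimpleGraph V) [DecidableRel G.Adj]
    {α : V → V → ℝ} (hα : IsParameter G α) {s : V → ℝ} (hs : ∀ i, s i ≠ 0) (x₀ : V → ℤ) (t : ℕ)
    {B : ℝ}
    (hB : ∀ k, ∑ τ ∈ Finset.range t, gradientSq G ((diffusionMatrix G α s ^ τ) k) ≤ B)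
    {θ δ : ℝ} (hθ : 0 ≤ θ) :
    (discreteLoad G α s x₀ t).toMeasure
      {X | ∀ k, |(X k : ℝ) - contLoad G α s (fun i => (x₀ i : ℝ)) t k| ≤ δ}ᶜ ≤
      ENNReal.ofReal (Fintype.card V *
        (2 * Real.exp (θ ^ 2 * (G.maxDegree * B) / 2 - θ * δ))) := by
  set p := discreteLoad G α s x₀ t with hp
  set x := contLoad G α s (fun i => (x₀ i : ℝ)) t with hx
  set w : ℝ → V → (V → ℤ) → ENNReal := fun θ k X =>
    ENNReal.ofReal (Real.exp (θ * (X k - x k))) with hw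
  set c := ENNReal.ofReal (Real.exp (-(θ * δ))) with hc
  have hpoint : ∀ X, ({X | ∀ k, |(X k : ℝ) - x k| ≤ δ}ᶜ : Set (V → ℤ)).indicator p X ≤
      ∑ k, (p X * w θ k X + p X * w (-θ) k X) * c := fun X => by
    by_cases hX : X ∈ ({X | ∀ k, |(X k : ℝ) - x k| ≤ δ}ᶜ : Set (V → ℤ))
    · rw [Set.indicator_of_mem hX]
      simp only [Set.mem_compl_iff, Set.mem_ofPred_eq, not_forall, not_le] at hX
      obtain ⟨k, hk⟩ := hX
      refine le_trans ?_ (Finset.single_le_sum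
        (f := fun k => (p X * w θ k X + p X * w (-θ) k X) * c) (fun _ _ => zero_le)
        (Finset.mem_univ k))
      rw [← mul_add, mul_assoc]
      refine le_mul_of_one_le_right zero_le ?_
      rw [hw, hc, ← ENNReal.ofReal_add (Real.exp_pos _).le (Real.exp_pos _).le,
        ← ENNReal.ofReal_mul (by positivity), ← ENNReal.ofReal_one]
      refine ENNReal.ofReal_le_ofReal ?_
      rw [add_mul, ← Real.exp_add, ← Real.exp_add]
      -- On the bad event one of the two exponential weights, for `θ` or `-θ`, is already at least
      -- `exp (θ * δ)`.
      rcases lt_abs.1 hk with h | h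
      · have := Real.one_le_exp (x := θ * (X k - x k) + -(θ * δ)) (by nlinarith)
        linarith [Real.exp_pos (-θ * (X k - x k) + -(θ * δ))]
      · have := Real.one_le_exp (x := -θ * (X k - x k) + -(θ * δ)) (by nlinarith)
        linarith [Real.exp_pos (θ * (X k - x k) + -(θ * δ))]
    · rw [Set.indicator_of_notMem hX]
      exact zero_le
  have hexp := fun θ k => tsum_discreteLoad_mul_exp_coord_le G hα hs x₀ t (hB k) θ
  rw [PMF.toMeasure_apply _ (Set.to_countable _).measurableSet]
  refine (ENNReal.tsum_le_tsum hpoint).trans ?_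
  rw [Summable.tsum_finsetSum fun _ _ => ENNReal.summable]
  have hk : ∀ k ∈ Finset.univ, ∑' X, (p X * w θ k X + p X * w (-θ) k X) * c ≤
      ENNReal.ofReal (2 * Real.exp (θ ^ 2 * (G.maxDegree * B) / 2 - θ * δ)) := fun k _ => by
    have h2 := hexp (-θ) k
    rw [neg_sq] at h2
    rw [ENNReal.tsum_mul_right, ENNReal.tsum_add]
    refine (mul_le_mul_left (add_le_add (hexp θ k) h2) _).trans (le_of_eq ?_)
    rw [hc, ← ENNReal.ofReal_add (Real.exp_pos _).le (Real.exp_pos _).le,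
      ← ENNReal.ofReal_mul (by positivity), ← two_mul, mul_assoc, ← Real.exp_add, sub_eq_add_neg]
  refine (Finset.sum_le_sum hk).trans (le_of_eq ?_)
  rw [Finset.sum_const, Finset.card_univ, nsmul_eq_mul,
    ENNReal.ofReal_mul (Nat.cast_nonneg _), ENNReal.ofReal_natCast]

/-- The indicator of an isolated node would have zero energy without being constant. Positivity is
needed to divide by the variance proxy. -/
theorem maxDegree_pos (G : SimpleGraph V) [DecidableRel G.Adj] {α : V → V → ℝ}
    (hα : IsParameter G α) {s : V → ℝ} (hs : ∀ i, 1 ≤ s i)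
    (hl : secondEigenvalue (diffusionMatrix G α s) < 1) [Nontrivial V] : 0 < G.maxDegree := by
  obtain ⟨i, j, hij⟩ := exists_pair_ne V
  by_contra h
  have hdeg : G.degree i = 0 := by
    have := G.degree_le_maxDegree i
    omega
  rw [← G.card_neighborFinset_eq_degree, Finset.card_eq_zero] at hdeg
  have hE : energy G α (Pi.single i 1) ≤ 0 := by rw [energy_single G hα, hdeg]; simp
  have := eq_of_energy_nonpos G hα hs hl hE i j
  simp [hij.symm] at this

end Diffusion

/-! ### The main theorem: choice of constants -/

theorem mainTheorem3 :
    ∃ a : ℝ, 0 < a ∧ ∀ κ : ℝ, 0 < κ → ∃ C : ℝ, 0 < C ∧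
      ∀ (n : ℕ) (G : SimpleGraph (Fin n)) [DecidableRel G.Adj]
        (α : Fin n → Fin n → ℝ) (s : Fin n → ℝ),
        Diffusion.IsParameter G α →
        (∀ i, 1 ≤ s i) →
        ((∀ i j, s i = s j) ∨
          ∀ i j k, G.Adj i j →
            κ * ∑ l ∈ G.neighborFinset k, α k l ≤ (G.maxDegree : ℝ) * α i j) →
        Diffusion.secondEigenvalue (Diffusion.diffusionMatrix G α s) < 1 →
        Diffusion.refinedLocalDivergence G α s ≤
            ENNReal.ofReal (C * √((G.maxDegree : ℝ) * (1 + Real.log (⨆ i, s i)) /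
              (1 - Diffusion.secondEigenvalue (Diffusion.diffusionMatrix G α s)))) ∧
          ∀ (x₀ : Fin n → ℤ) (t : ℕ),
            ENNReal.ofReal (1 - (n : ℝ) ^ (-a)) ≤
              (Diffusion.discreteLoad G α s x₀ t).toMeasure
                {X | ∀ k, |(X k : ℝ) -
                    Diffusion.contLoad G α s (fun i => (x₀ i : ℝ)) t k| ≤
                  C * ((G.maxDegree : ℝ) * √(Real.log n * (1 + Real.log (⨆ i, s i)) /
                    (1 - Diffusion.secondEigenvalue (Diffusion.diffusionMatrix G α s))))} := by
  -- The factor `4 + 2 / κ` comes from the gradient bound; the extra `6` makes the Chernoff exponent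
  -- at most `-3 * log n`.
  refine ⟨1, one_pos, fun κ hκ => ⟨√(6 * (4 + 2 / κ)), by positivity, ?_⟩⟩
  intro n G _ α s hα hs hcase hl
  have hs0 : ∀ i, s i ≠ 0 := fun i => (zero_lt_one.trans_le (hs i)).ne'
  have hsum := Diffusion.sum_gradientSq_row_le G hα hs hκ hcase hl
  have hc : 0 < 4 + 2 / κ := by positivity
  set l := Diffusion.secondEigenvalue (Diffusion.diffusionMatrix G α s) with hldef
  set c := 4 + 2 / κ with hcdef
  set S := 1 + Real.log (⨆ i, s i) with hS
  have hl' : 0 < 1 - l := by linarith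
  have hS1 : 1 ≤ S := by
    have : 0 ≤ Real.log (⨆ i, s i) := by
      rcases isEmpty_or_nonempty (Fin n) with he | ⟨⟨i⟩⟩
      · rw [Real.iSup_of_isEmpty, Real.log_zero]
      · exact Real.log_nonneg ((hs i).trans (le_ciSup (Set.finite_range s).bddAbove i))
    linarith
  have hd : (0 : ℝ) ≤ G.maxDegree := Nat.cast_nonneg _
  refine ⟨(Diffusion.refinedLocalDivergence_le G hs0 hsum).trans
    (ENNReal.ofReal_le_ofReal ?_), fun x₀ t => ?_⟩
  · rw [← Real.sqrt_mul (by positivity)]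
    refine Real.sqrt_le_sqrt ?_
    rw [← mul_div_assoc]
    refine div_le_div_of_nonneg_right ?_ hl'.le
    have h1 : (G.maxDegree : ℝ) * 1 ≤ G.maxDegree * S := mul_le_mul_of_nonneg_left hS1 hd
    have h2 := mul_le_mul_of_nonneg_left h1 hc.le
    have h3 : 0 ≤ c * (G.maxDegree * S) := by positivity
    linarith
  · rcases Nat.lt_or_ge n 2 with hn | hn
    -- For `n = 0` the event is the whole space; for `n = 1` the claimed lower bound `1 - n ^ (-1)`
    -- is zero.
    · obtain h0 | h1 : n = 0 ∨ n = 1 := by omega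
      · have hempty : IsEmpty (Fin n) := by rw [h0]; infer_instance
        rw [Set.eq_univ_of_forall (s := Set.ofPred _) fun X k => hempty.elim k,
          MeasureTheory.measure_univ]
        exact ENNReal.ofReal_le_one.2 (sub_le_self _ (by positivity))
      · have h1' : (n : ℝ) = 1 := by exact_mod_cast h1
        rw [ENNReal.ofReal_of_nonpos (by rw [h1']; simp)]
        exact zero_le
    · have : Nontrivial (Fin n) := Fin.nontrivial_iff_two_le.2 hn
      have hdpos : (0 : ℝ) < G.maxDegree := Nat.cast_pos.2 (Diffusion.maxDegree_pos G hα hs hl)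
      have hn1 : (1 : ℝ) < n := by exact_mod_cast hn
      have hlog : 0 < Real.log n := Real.log_pos hn1
      set δ := √(6 * c) * ((G.maxDegree : ℝ) * √(Real.log n * S / (1 - l))) with hδ
      set B := c * G.maxDegree / (1 - l) with hBdef
      have hBpos : 0 < G.maxDegree * B := by positivity
      have hδsq : 6 * Real.log n * (G.maxDegree * B) ≤ δ ^ 2 := by
        have h1 : δ ^ 2 = 6 * c * (G.maxDegree ^ 2 * (Real.log n * S / (1 - l))) := by
          rw [hδ, mul_pow, mul_pow, Real.sq_sqrt (by positivity), Real.sq_sqrt (by positivity)]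
        have h2 : 6 * Real.log n * (G.maxDegree * B) * S = δ ^ 2 := by
          rw [h1, hBdef]
          ring
        rw [← h2]
        exact le_mul_of_one_le_right (by positivity) hS1
      -- This `θ` minimizes `θ ^ 2 * (d * B) / 2 - θ * δ`, with minimum `-δ ^ 2 / (2 * d * B)`.
      have hbad := Diffusion.toMeasure_deviation_le G hα hs0 x₀ t (fun k => hsum k t)
        (δ := δ) (θ := δ / (G.maxDegree * B)) (by positivity)
      have hexp : Real.exp ((δ / (G.maxDegree * B)) ^ 2 * (G.maxDegree * B) / 2 -
          δ / (G.maxDegree * B) * δ) ≤ ((n : ℝ) ^ 3)⁻¹ := by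
        have h1 : (δ / (G.maxDegree * B)) ^ 2 * (G.maxDegree * B) / 2 -
            δ / (G.maxDegree * B) * δ = -(δ ^ 2 / (G.maxDegree * B) / 2) := by
          field_simp
          ring
        have h2 : 6 * Real.log n ≤ δ ^ 2 / (G.maxDegree * B) := (le_div_iff₀ hBpos).2 hδsq
        rw [h1, ← Real.exp_log (by positivity : 0 < ((n : ℝ) ^ 3)⁻¹), Real.log_inv, Real.log_pow]
        refine Real.exp_le_exp.2 ?_
        push_cast
        linarith
      have hfin : (Fintype.card (Fin n) : ℝ) * (2 * Real.exp ((δ / (G.maxDegree * B)) ^ 2 *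
          (G.maxDegree * B) / 2 - δ / (G.maxDegree * B) * δ)) ≤ (n : ℝ) ^ (-1 : ℝ) := by
        rw [Fintype.card_fin, Real.rpow_neg_one]
        have hn2 : (2 : ℝ) ≤ n := by exact_mod_cast hn
        -- The factor `2` for the two tails is absorbed by `2 ≤ n`, leaving `n * n * n⁻³`.
        calc (n : ℝ) * (2 * Real.exp ((δ / (G.maxDegree * B)) ^ 2 *
              (G.maxDegree * B) / 2 - δ / (G.maxDegree * B) * δ))
            ≤ n * (n * ((n : ℝ) ^ 3)⁻¹) := by gcongr
          _ = (n : ℝ)⁻¹ := by field_simp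
      have hbad' := hbad.trans (ENNReal.ofReal_le_ofReal hfin)
      set E := {X : Fin n → ℤ | ∀ k, |(X k : ℝ) -
        Diffusion.contLoad G α s (fun i => (x₀ i : ℝ)) t k| ≤ δ} with hE
      have hEm : MeasurableSet E := (Set.to_countable _).measurableSet
      rw [ENNReal.ofReal_sub _ (by positivity), ENNReal.ofReal_one, tsub_le_iff_right,
        ← MeasureTheory.prob_add_prob_compl (μ := (Diffusion.discreteLoad G α s x₀ t).toMeasure) hEm]
      exact add_le_add le_rfl hbad'
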